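/- **Setting.** A finite-horizon MDP has $S$ states, $A$ actions, $H$ steps per episode, a stationary transition probability $\mathbb P(\cdot\mid x,a)$, a fixed initial state $x_1$ and deterministic rewards $r_h(x,a)\in[0,1]$, $h=1,\dots,H$. For a (possibly randomized, step-dependent) Markov policy $\pi$, $V^\pi_h(x)$ and $Q^\pi_h(x,a)$ are its values from step $h$ on, and $V^*_h$, $Q^*_h$ are the optimal values, i.e. the suprema over $\pi$. Put $\mathrm{gap}_h(x,a)=V^*_h(x)-Q^*_h(x,a)$ and $\mathrm{gap}_{\min}(r)=\min\{\mathrm{gap}_h(x,a):\mathrm{gap}_h(x,a)>0\}$, the minimum being over all $h,x,a$ ($+\infty$ if there is no positive gap). A *gap-TAE instance* with gap parameter $\rho>0$ is a transition probability $\mathbb P$ together with a nonempty set $\mathcal R$ of reward functions such that $\rho\le\mathrm{gap}_{\min}(r)$ for every $r\in\mathcal R$. An *algorithm* (randomized and adaptive, knowing $S,A,H,x_1,\rho,\epsilon,\delta$ and possibly $\mathcal R$, but not $\mathbb P$) first runs $K$ episodes without seeing rewards, where $K$ may be a random stopping time (possibly infinite), then is given a reward function $r\in\mathcal R$ and returns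 a possibly random policy $\pi$. It is *$(\epsilon,\delta)$-PAC* if on every gap-TAE instance with gap parameter $\rho$, for every $r\in\mathcal R$ fixed in advance, the probability that it returns a policy $\pi$ with $V^*_1(x_1)-V^\pi_1(x_1)>\epsilon$ is less than $\delta$. For constants $c_1,c_2,\rho_0,\delta_0>0$ let $\mathrm{LB}(S,A,H;c_1,c_2,\rho_0,\delta_0)$ be the assertion: for all $\rho\in(0,\rho_0)$, $\epsilon\in(0,\rho)$, $\delta\in(0,\delta_0)$ and every $(\epsilon,\delta)$-PAC algorithm there is a gap-TAE instance with gap parameter $\rho$ ($S$ states, $A$ actions, horizon $H$) on which $$\mathbb E[K]\ \ge\ c_1\cdot\frac{H^2SA}{\rho\,\epsilon}\cdot\log\frac{c_2}{\delta}.$$ **Theorem.** (i) Fix $S\ge5$, $A\ge2$ and $H\ge2+\log_AS$. There exist positive constants $c_1,c_2,\rho_0,\delta_0$ (which may depend on $S,A,H$) such that $\mathrm{LB}(S,A,H;c_1,c_2,\rho_0,\delta_0)$ holds. (ii) There exist universal positive constants $c_1,c_2,\rho_0,\delta_0$ such that $\mathrm{LB}(S,A,H;c_1,c_2,\rho_0,\delta_0)$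 holds for all $S\ge5$, $A\ge2$ and $H\ge2\,(2+\log_AS)$. -/

import Mathlib

open scoped ENNReal
open MeasureTheory

noncomputable section

/-! Finite-horizon MDPs with states `Fin S`, actions `Fin A` and steps `Fin H`
(step `h` of the informal text, counted from `1`, is the element `h - 1` of `Fin H`). -/

/-- A stationary transition probability: `P x a` is the law of the next state. -/
abbrev Transition (S A : ℕ) : Type := Fin S → Fin A → stdSimplex ℝ (Fin S)

/-- A deterministic, step-dependent reward function with values in `[0,1]`. -/
abbrev Reward (S A H : ℕ) : Type := Fin H → Fin S → Fin A → unitInterval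

/-- A (possibly randomized, step-dependent) Markov policy. -/
abbrev Policy (S A H : ℕ) : Type := Fin H → Fin S → stdSimplex ℝ (Fin A)

/-- The value `V^π_h(x)`: the expected reward collected from step `h` on, starting in `x` and
following `π`. It is zero after the last step. -/
def policyValue {S A H : ℕ} (P : Transition S A) (r : Reward S A H) (π : Policy S A H)
    (h : ℕ) (x : Fin S) : ℝ :=
  if hh : h < H then
    ∑ a, (π ⟨h, hh⟩ x) a *
      ((r ⟨h, hh⟩ x a : ℝ) + ∑ y, (P x a) y * policyValue P r π (h + 1) y)
  else 0
termination_by H - h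

/-- The value `Q^π_h(x,a)`: take action `a` in state `x` at step `h`, then follow `π`. -/
def policyQ {S A H : ℕ} (P : Transition S A) (r : Reward S A H) (π : Policy S A H)
    (h : Fin H) (x : Fin S) (a : Fin A) : ℝ :=
  (r h x a : ℝ) + ∑ y, (P x a) y * policyValue P r π ((h : ℕ) + 1) y

/-- The optimal value `V*_h(x)`, the supremum of `V^π_h(x)` over all policies. -/
def optValue {S A H : ℕ} (P : Transition S A) (r : Reward S A H) (h : ℕ) (x : Fin S) : ℝ :=
  ⨆ π : Policy S A H, policyValue P r π h x

/-- The optimal value `Q*_h(x,a)`, the supremum of `Q^π_h(x,a)` over all policies. -/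
def optQ {S A H : ℕ} (P : Transition S A) (r : Reward S A H)
    (h : Fin H) (x : Fin S) (a : Fin A) : ℝ :=
  ⨆ π : Policy S A H, policyQ P r π h x a

/-- The sub-optimality gap `V*_h(x) - Q*_h(x,a)`. -/
def gap {S A H : ℕ} (P : Transition S A) (r : Reward S A H)
    (h : Fin H) (x : Fin S) (a : Fin A) : ℝ :=
  optValue P r (h : ℕ) x - optQ P r h x a

/-- The minimum sub-optimality gap: the smallest positive gap over all steps, states and actions
(`⊤` if there is no positive gap). -/
def gapMin {S A H : ℕ} (P : Transition S A) (r : Reward S A H) : EReal :=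
  ⨅ (h : Fin H) (x : Fin S) (a : Fin A) (_ : 0 < gap P r h x a), (gap P r h x a : EReal)

/-- `(P, R)` is an instance of gap-dependent task-agnostic exploration with gap parameter `ρ`:
`0 < ρ ≤ gap_min(r)` for each reward function `r` of the nonempty candidate set `R`. -/
def IsGapTAE {S A H : ℕ} (ρ : ℝ) (P : Transition S A) (R : Set (Reward S A H)) : Prop :=
  R.Nonempty ∧ 0 < ρ ∧ ∀ r ∈ R, (ρ : EReal) ≤ gapMin P r

/-- What is observed in an episode that starts in the known initial state: at each step the
action taken and the state that follows. -/
abbrev Episode (S A H : ℕ) : Type := Fin H → Fin A × Fin S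

/-- The state in which step `h` of the episode `e` is taken. -/
def stateAt {S A H : ℕ} (x₁ : Fin S) (e : Episode S A H) (h : Fin H) : Fin S :=
  if (h : ℕ) = 0 then x₁ else (e ⟨(h : ℕ) - 1, by omega⟩).2

/-- A randomized algorithm: an exploration phase without rewards, and a planning phase.
A list of episodes is the data collected so far, the most recent episode first.
* `explore w h u`: the law of the action at step `h` of the episode that follows the data `w`,
  when the steps of that episode before `h` were `u`.
* `halt w`: the probability of ending the exploration phase with the data `w`,
  once `w` has been collected.
* `plan w r`: the law of the policy that is returned for the revealed reward function `r`
  when exploration has ended with the data `w`. -/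
structure Algorithm (S A H : ℕ) where
  explore : List (Episode S A H) → (h : Fin H) → (Fin (h : ℕ) → Fin A × Fin S) →
    stdSimplex ℝ (Fin A)
  halt : List (Episode S A H) → unitInterval
  plan : List (Episode S A H) → Reward S A H → ProbabilityMeasure (Policy S A H)

namespace Algorithm

variable {S A H : ℕ}

/-- The probability that the episode which follows the data `w` is `e`. -/
def episodeProb (alg : Algorithm S A H) (x₁ : Fin S) (P : Transition S A)
    (w : List (Episode S A H)) (e : Episode S A H) : ℝ :=
  ∏ h : Fin H, (alg.explore w h fun i => e (Fin.castLE h.isLt.le i)) (e h).1 *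
    (P (stateAt x₁ e h) (e h).1) (e h).2

/-- The probability that exploration lasts for at least `w.length` episodes and that the first
`w.length` episodes are `w`. -/
def reachProb (alg : Algorithm S A H) (x₁ : Fin S) (P : Transition S A) :
    List (Episode S A H) → ℝ
  | [] => 1
  | e :: w => alg.reachProb x₁ P w * (1 - (alg.halt w : ℝ)) * alg.episodeProb x₁ P w e

/-- The probability `ℙ(K = w.length and the collected data are w)`, where `K` is the number of
episodes of the exploration phase. -/
def haltProb (alg : Algorithm S A H) (x₁ : Fin S) (P : Transition S A)
    (w : List (Episode S A H)) : ℝ :=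
  alg.reachProb x₁ P w * (alg.halt w : ℝ)

open Classical in
/-- The probability `ℙ(K > k)`, where `K` is the number of episodes of the exploration phase
(`K = ∞` if exploration never ends). -/
def tailProb (alg : Algorithm S A H) (x₁ : Fin S) (P : Transition S A) (k : ℕ) : ℝ≥0∞ :=
  ∑' w : List (Episode S A H),
    if w.length = k then ENNReal.ofReal (alg.reachProb x₁ P w * (1 - (alg.halt w : ℝ))) else 0

/-- The expected number of episodes, `𝔼[K] = ∑ k, ℙ(K > k)`. -/
def expectedEpisodes (alg : Algorithm S A H) (x₁ : Fin S) (P : Transition S A) : ℝ≥0∞ :=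
  ∑' k : ℕ, alg.tailProb x₁ P k

/-- The probability `ℙ(V*_1(x₁) - V^π_1(x₁) > ε)` that the policy `π` returned for the reward
function `r` is not `ε`-optimal. A run that never ends returns no policy and is not counted here;
it counts as `K = ∞` in `𝔼[K]`. -/
def errorProb (alg : Algorithm S A H) (x₁ : Fin S) (P : Transition S A) (r : Reward S A H)
    (ε : ℝ) : ℝ≥0∞ :=
  ∑' w : List (Episode S A H), ENNReal.ofReal (alg.haltProb x₁ P w) *
    (alg.plan w r : Measure (Policy S A H))
      {π | ε < optValue P r 0 x₁ - policyValue P r π 0 x₁}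

end Algorithm

/-- `(ε,δ)`-PAC for gap-dependent task-agnostic exploration with gap parameter `ρ`. The algorithm
may use the candidate set `R`, but neither the transition probability nor, while it explores, the
reward function, which is chosen in `R` beforehand. -/
def IsPAC {S A H : ℕ} (alg : Set (Reward S A H) → Algorithm S A H) (x₁ : Fin S)
    (ρ ε δ : ℝ) : Prop :=
  ∀ (P : Transition S A) (R : Set (Reward S A H)), IsGapTAE ρ P R →
    ∀ r ∈ R, (alg R).errorProb x₁ P r ε < ENNReal.ofReal δ

/-- The lower bound for `S` states, `A` actions and horizon `H`, with the given constants. -/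
def EpisodeLowerBound (S A H : ℕ) (c₁ c₂ ρ₀ δ₀ : ℝ) : Prop :=
  ∀ ρ ε δ : ℝ, 0 < ρ → ρ < ρ₀ → 0 < ε → ε < ρ → 0 < δ → δ < δ₀ →
    ∀ (x₁ : Fin S) (alg : Set (Reward S A H) → Algorithm S A H), IsPAC alg x₁ ρ ε δ →
      ∃ (P : Transition S A) (R : Set (Reward S A H)), IsGapTAE ρ P R ∧
        ENNReal.ofReal (c₁ * ((H : ℝ) ^ 2 * S * A / (ρ * ε)) * Real.log (c₂ / δ)) ≤
          (alg R).expectedEpisodes x₁ P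

end

/-!
The lower bound is a change-of-measure argument for a family of instances that hide a bandit
problem behind a rarely entered tree.

From the initial state the root of a tree is entered only with probability `ε / ρ`, whatever the
action. At a leaf, each action leads to the absorbing state `good` or to the absorbing state `bad`.
In the baseline, the action `safe` reaches `good` with probability `1 / 2 + Δ` and all other actions
with probability `1 / 2`; the alternatives raise one of the latter, an arm `l`, to `1 / 2 + 2 Δ`.
The state `good` pays in `L` steps, where `Δ L = 3 ρ`. The tree is deterministic, so every positive
gap in it is `3 ρ` or `6 ρ`, as long as enough time is left; in the late steps the reward makes all
nodes equally valuable, which keeps small gaps from arising there (`Maze.le_gap`). A policy cannot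
be near-optimal both in the baseline and in an alternative: the two sub-optimalities add up to at
least `(ε / ρ) * 3 ρ > 2 ε` (`Maze.suboptimal_or_suboptimal`). Thus an algorithm that errs with
probability less than `δ` has to distinguish the baseline from each alternative.

The variational form of the data processing inequality (`Algorithm.le_truncExp_dataSum`) then
shows that the expected log-likelihood ratio of the exploration data, under the baseline, is at
least `log (1 / (8 δ)) / 2` for each arm. On the other hand an episode reveals something about at
most one arm, only if the root is entered, and then at most `16 Δ ^ 2`. The bound on the
information per episode is proved with a potential on the states
(`Algorithm.sum_episodeProb_mul_episodeSum_le`), and it carries over to the stopped process by a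
one-sided form of Wald's identity (`Algorithm.truncExp_dataSum_le`). All expectations are taken
after finitely many episodes, so that only finite sums occur. Summing over the `n` arms gives
`n * log (1 / (8 δ)) / 2 ≤ (ε / ρ) * 16 * (3 ρ / L) ^ 2 * 𝔼[K]`.

With a tree in heap order `n` is of order `S A`, and `L` is of order `H` if `H` is at least twice
the depth. A single leaf is enough when the constants may depend on `S`, `A` and `H`.
-/

/-! ### Bellman's optimality equations -/

section Bellman

variable {S A H : ℕ} {P : Transition S A} {r : Reward S A H} {π : Policy S A H}

theorem policyValue_of_lt {h : ℕ} (hh : h < H) (x : Fin S) :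
    policyValue P r π h x = ∑ a, (π ⟨h, hh⟩ x) a * policyQ P r π ⟨h, hh⟩ x a := by
  rw [policyValue, dif_pos hh]
  rfl

theorem policyValue_of_le {h : ℕ} (hh : H ≤ h) (x : Fin S) : policyValue P r π h x = 0 := by
  rw [policyValue, dif_neg hh.not_gt]

theorem policyValue_eq_of_forall_policyQ {h : ℕ} (hh : h < H) {x : Fin S} {c : ℝ}
    (hc : ∀ a, policyQ P r π ⟨h, hh⟩ x a = c) : policyValue P r π h x = c := by
  rw [policyValue_of_lt hh]
  simp only [hc, ← Finset.sum_mul, stdSimplex.sum_eq_one, one_mul]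

/-- The solution of Bellman's optimality equations, by backward recursion. -/
noncomputable def bellmanValue (P : Transition S A) (r : Reward S A H) (h : ℕ) (x : Fin S) : ℝ :=
  if hh : h < H then
    ⨆ a, ((r ⟨h, hh⟩ x a : ℝ) + ∑ y, (P x a) y * bellmanValue P r (h + 1) y)
  else 0
termination_by H - h

theorem bellmanValue_of_lt {h : ℕ} (hh : h < H) (x : Fin S) :
    bellmanValue P r h x =
      ⨆ a, ((r ⟨h, hh⟩ x a : ℝ) + ∑ y, (P x a) y * bellmanValue P r (h + 1) y) := by
  rw [bellmanValue, dif_pos hh]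

theorem bellmanValue_of_le {h : ℕ} (hh : H ≤ h) (x : Fin S) : bellmanValue P r h x = 0 := by
  rw [bellmanValue, dif_neg hh.not_gt]

theorem policyValue_le_bellmanValue (π : Policy S A H) (h : ℕ) (x : Fin S) :
    policyValue P r π h x ≤ bellmanValue P r h x := by
  rcases lt_or_ge h H with hh | hh
  · have ih := policyValue_le_bellmanValue π (h + 1)
    rw [policyValue_of_lt hh]
    calc ∑ a, (π ⟨h, hh⟩ x) a * policyQ P r π ⟨h, hh⟩ x a
        ≤ ∑ a, (π ⟨h, hh⟩ x) a * bellmanValue P r h x := by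
          refine Finset.sum_le_sum fun a _ =>
            mul_le_mul_of_nonneg_left ?_ (stdSimplex.zero_le _ a)
          rw [bellmanValue_of_lt hh]
          refine le_trans ?_ (le_ciSup (Set.finite_range fun a =>
            ((r ⟨h, hh⟩ x a : ℝ) + ∑ y, (P x a) y * bellmanValue P r (h + 1) y)).bddAbove a)
          refine add_le_add le_rfl (Finset.sum_le_sum fun y _ => ?_)
          exact mul_le_mul_of_nonneg_left (ih y) (stdSimplex.zero_le _ y)
      _ = bellmanValue P r h x := by
          rw [← Finset.sum_mul, stdSimplex.sum_eq_one, one_mul]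
  · rw [policyValue_of_le hh, bellmanValue_of_le hh]
termination_by H - h

/-- A lower bound on all positive gaps is a lower bound on their minimum. -/
theorem le_gapMin {ρ : ℝ} (hρ : ∀ h x a, 0 < gap P r h x a → ρ ≤ gap P r h x a) :
    (ρ : EReal) ≤ gapMin P r :=
  le_iInf fun h => le_iInf fun x => le_iInf fun a => le_iInf fun hpos =>
    EReal.coe_le_coe_iff.2 (hρ h x a hpos)

variable [Nonempty (Fin A)]

/-- The greedy policy attains the solution of Bellman's equations. -/
theorem exists_policyValue_eq_bellmanValue (P : Transition S A) (r : Reward S A H) :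
    ∃ π : Policy S A H, ∀ h x, policyValue P r π h x = bellmanValue P r h x := by
  have key : ∀ (h : Fin H) (x : Fin S), ∃ a,
      ((r h x a : ℝ) + ∑ y, (P x a) y * bellmanValue P r (h + 1) y) = bellmanValue P r h x := by
    intro h x
    rw [bellmanValue_of_lt h.isLt]
    exact exists_eq_ciSup_of_finite
  choose g hg using key
  let π : Policy S A H := fun h x => ⟨Pi.single (g h x) 1, single_mem_stdSimplex ℝ _⟩
  refine ⟨π, ?_⟩
  have main : ∀ n h, H - h = n → ∀ x, policyValue P r π h x = bellmanValue P r h x := by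
    intro n
    induction n with
    | zero =>
      intro h hn x
      have hh : H ≤ h := by omega
      rw [policyValue_of_le hh, bellmanValue_of_le hh]
    | succ n ih =>
      intro h hn x
      have hh : h < H := by omega
      have hπ : ∀ a, (π ⟨h, hh⟩ x) a = (Pi.single (g ⟨h, hh⟩ x) (1 : ℝ) : Fin A → ℝ) a :=
        fun _ => rfl
      rw [policyValue_of_lt hh, Finset.sum_eq_single (g ⟨h, hh⟩ x)]
      · rw [hπ, Pi.single_eq_same, one_mul, ← hg ⟨h, hh⟩ x, policyQ]
        simp only [ih (h + 1) (by omega)]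
      · intro a _ ha
        rw [hπ, Pi.single_eq_of_ne ha, zero_mul]
      · simp
  exact fun h x => main _ h rfl x

instance : Nonempty (Policy S A H) :=
  ⟨fun _ _ => ⟨_, single_mem_stdSimplex ℝ (Classical.arbitrary (Fin A))⟩⟩

theorem optValue_eq_bellmanValue (h : ℕ) (x : Fin S) :
    optValue P r h x = bellmanValue P r h x := by
  obtain ⟨π, hπ⟩ := exists_policyValue_eq_bellmanValue P r
  refine le_antisymm (ciSup_le fun π => policyValue_le_bellmanValue π h x) ?_
  rw [← hπ]
  exact le_ciSup (f := fun π : Policy S A H => policyValue P r π h x)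
    ⟨_, Set.forall_mem_range.2 fun π => policyValue_le_bellmanValue π h x⟩ π

theorem policyValue_le_optValue (π : Policy S A H) (h : ℕ) (x : Fin S) :
    policyValue P r π h x ≤ optValue P r h x :=
  (policyValue_le_bellmanValue π h x).trans_eq (optValue_eq_bellmanValue h x).symm

theorem exists_policyValue_eq_optValue (P : Transition S A) (r : Reward S A H) :
    ∃ π : Policy S A H, ∀ h x, policyValue P r π h x = optValue P r h x := by
  obtain ⟨π, hπ⟩ := exists_policyValue_eq_bellmanValue P r
  exact ⟨π, fun h x => (hπ h x).trans (optValue_eq_bellmanValue h x).symm⟩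

theorem optValue_of_le {h : ℕ} (hh : H ≤ h) (x : Fin S) : optValue P r h x = 0 := by
  rw [optValue_eq_bellmanValue, bellmanValue_of_le hh]

theorem optQ_eq (h : Fin H) (x : Fin S) (a : Fin A) :
    optQ P r h x a = (r h x a : ℝ) + ∑ y, (P x a) y * optValue P r ((h : ℕ) + 1) y := by
  have hle : ∀ π : Policy S A H, policyQ P r π h x a ≤
      (r h x a : ℝ) + ∑ y, (P x a) y * optValue P r ((h : ℕ) + 1) y := fun π =>
    add_le_add le_rfl (Finset.sum_le_sum fun y _ =>
      mul_le_mul_of_nonneg_left (policyValue_le_optValue π _ y) (stdSimplex.zero_le _ y))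
  obtain ⟨π, hπ⟩ := exists_policyValue_eq_optValue P r
  refine le_antisymm (ciSup_le hle) ?_
  have hπQ : policyQ P r π h x a =
      (r h x a : ℝ) + ∑ y, (P x a) y * optValue P r ((h : ℕ) + 1) y := by
    simp only [policyQ, hπ]
  rw [← hπQ]
  exact le_ciSup (f := fun π : Policy S A H => policyQ P r π h x a)
    ⟨_, Set.forall_mem_range.2 hle⟩ π

theorem optValue_eq_ciSup_optQ (h : Fin H) (x : Fin S) :
    optValue P r (h : ℕ) x = ⨆ a, optQ P r h x a := by
  simp only [optQ_eq, optValue_eq_bellmanValue]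
  exact bellmanValue_of_lt h.isLt x

theorem optQ_le_optValue (h : Fin H) (x : Fin S) (a : Fin A) :
    optQ P r h x a ≤ optValue P r (h : ℕ) x := by
  rw [optValue_eq_ciSup_optQ]
  exact le_ciSup (Set.finite_range fun a => optQ P r h x a).bddAbove a

theorem exists_optQ_eq_optValue (P : Transition S A) (r : Reward S A H) (h : Fin H) (x : Fin S) :
    ∃ a, optQ P r h x a = optValue P r (h : ℕ) x := by
  rw [optValue_eq_ciSup_optQ]
  exact exists_eq_ciSup_of_finite

theorem optValue_eq_of_forall_optQ {h : Fin H} {x : Fin S} {c : ℝ}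
    (hc : ∀ a, optQ P r h x a = c) : optValue P r (h : ℕ) x = c := by
  obtain ⟨a, ha⟩ := exists_optQ_eq_optValue P r h x
  rw [← ha, hc]

end Bellman

/-! ### Sums along one episode -/

section Paths

variable {X : Type*} [Fintype X]

/-- Summation over tuples splits into the summation over the last entry and over the others. -/
theorem sum_tuple_succ {n : ℕ} (F : (Fin (n + 1) → X) → ℝ) :
    ∑ e, F e = ∑ u : Fin n → X, ∑ x, F (Fin.snoc u x) := by
  rw [← (Fin.snocEquiv fun _ : Fin (n + 1) => X).sum_comp, Fintype.sum_prod_type_right]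
  rfl

/-- A function `D` of the history that does not increase on average at any step of a
sequentially generated tuple has a final average at most its initial value. -/
theorem sum_prod_mul_le {n : ℕ} (κ : (h : Fin n) → (Fin h → X) → X → ℝ)
    (hκ : ∀ h u x, 0 ≤ κ h u x) (D : (h : ℕ) → (Fin h → X) → ℝ)
    (hD : ∀ (h : Fin n) (u : Fin h → X),
      ∑ x, κ h u x * D (h + 1) (Fin.snoc (α := fun _ => X) u x) ≤ D h u) :
    ∑ e : Fin n → X, (∏ h : Fin n, κ h (fun i => e (Fin.castLE h.isLt.le i)) (e h)) * D n e ≤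
      D 0 Fin.elim0 := by
  induction n with
  | zero =>
    simp only [Finset.univ_eq_empty, Finset.prod_empty, one_mul, Fintype.sum_unique]
    exact le_of_eq (congrArg _ (Subsingleton.elim _ _))
  | succ n ih =>
    refine le_trans ?_ (ih (fun h u x => κ h.castSucc u x) (fun h u x => hκ h.castSucc u x)
      (fun h u => hD h.castSucc u))
    rw [sum_tuple_succ]
    refine Finset.sum_le_sum fun u _ => ?_
    have hpre : ∀ (x : X) (h : Fin n),
        κ h.castSucc (fun i => (Fin.snoc u x : Fin (n + 1) → X)
            (Fin.castLE h.castSucc.isLt.le i)) ((Fin.snoc u x : Fin (n + 1) → X) h.castSucc) =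
          κ h.castSucc (fun i => u (Fin.castLE h.isLt.le i)) (u h) := by
      intro x h
      rw [Fin.snoc_castSucc]
      congr 1
      funext i
      exact Fin.snoc_castSucc (α := fun _ => X) x u (Fin.castLE h.isLt.le i)
    have hlast : ∀ x : X,
        κ (Fin.last n) (fun i => (Fin.snoc u x : Fin (n + 1) → X)
            (Fin.castLE (Fin.last n).isLt.le i))
            ((Fin.snoc u x : Fin (n + 1) → X) (Fin.last n)) = κ (Fin.last n) u x := by
      intro x
      rw [Fin.snoc_last]
      congr 1
      funext i
      exact Fin.snoc_castSucc (α := fun _ => X) x u i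
    simp only [Fin.prod_univ_castSucc, hlast, hpre, mul_assoc]
    rw [← Finset.mul_sum]
    exact mul_le_mul_of_nonneg_left (hD (Fin.last n) u)
      (Finset.prod_nonneg fun h _ => hκ _ _ _)

end Paths

section EpisodeData

variable {S A H : ℕ}

/-- The state that follows the steps `u` of an episode that starts in `x₁`. -/
def stateAfter (x₁ : Fin S) (h : ℕ) (u : Fin h → Fin A × Fin S) : Fin S :=
  if hh : h = 0 then x₁ else (u ⟨h - 1, by omega⟩).2

theorem stateAt_eq_stateAfter (x₁ : Fin S) (e : Episode S A H) (h : Fin H) :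
    stateAt x₁ e h = stateAfter x₁ h fun i => e (Fin.castLE h.isLt.le i) := by
  unfold stateAt stateAfter
  split <;> rfl

theorem stateAfter_succ_snoc (x₁ : Fin S) {h : ℕ} (u : Fin h → Fin A × Fin S)
    (z : Fin A × Fin S) :
    stateAfter x₁ (h + 1) (Fin.snoc (α := fun _ => Fin A × Fin S) u z) = z.2 := by
  have : (⟨h + 1 - 1, by omega⟩ : Fin (h + 1)) = Fin.last h := rfl
  rw [stateAfter, dif_neg (Nat.succ_ne_zero h), this, Fin.snoc_last]

/-- The sum of `f` over the transitions of an episode. -/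
def episodeSum (x₁ : Fin S) (f : Fin S → Fin A → Fin S → ℝ) (e : Episode S A H) : ℝ :=
  ∑ h, f (stateAt x₁ e h) (e h).1 (e h).2

/-- The sum of `f` over the transitions in a list of episodes. -/
def dataSum (x₁ : Fin S) (f : Fin S → Fin A → Fin S → ℝ) (w : List (Episode S A H)) : ℝ :=
  (w.map (episodeSum x₁ f)).sum

theorem dataSum_cons (x₁ : Fin S) (f : Fin S → Fin A → Fin S → ℝ) (e : Episode S A H)
    (w : List (Episode S A H)) :
    dataSum x₁ f (e :: w) = episodeSum x₁ f e + dataSum x₁ f w := by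
  simp [dataSum]

theorem dataSum_finsetSum {ι : Type*} (s : Finset ι) (x₁ : Fin S)
    (f : ι → Fin S → Fin A → Fin S → ℝ) (w : List (Episode S A H)) :
    ∑ i ∈ s, dataSum x₁ (f i) w = dataSum x₁ (fun x a y => ∑ i ∈ s, f i x a y) w := by
  induction w with
  | nil => simp [dataSum]
  | cons e w ih =>
    simp only [dataSum_cons, Finset.sum_add_distrib, ih, episodeSum]
    rw [Finset.sum_comm]

namespace Algorithm

variable (alg : Algorithm S A H) (x₁ : Fin S) (P : Transition S A)

theorem episodeProb_nonneg (w : List (Episode S A H)) (e : Episode S A H) :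
    0 ≤ alg.episodeProb x₁ P w e :=
  Finset.prod_nonneg fun _ _ => mul_nonneg (stdSimplex.zero_le _ _) (stdSimplex.zero_le _ _)

theorem reachProb_nonneg (w : List (Episode S A H)) : 0 ≤ alg.reachProb x₁ P w := by
  induction w with
  | nil => exact zero_le_one
  | cons e w ih =>
    exact mul_nonneg (mul_nonneg ih (sub_nonneg.2 (alg.halt w).2.2))
      (alg.episodeProb_nonneg x₁ P w e)

theorem haltProb_nonneg (w : List (Episode S A H)) : 0 ≤ alg.haltProb x₁ P w :=
  mul_nonneg (alg.reachProb_nonneg x₁ P w) (alg.halt w).2.1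

/-- The law of one step of an episode, given the steps before it. -/
def stepProb (w : List (Episode S A H)) (h : Fin H) (u : Fin h → Fin A × Fin S)
    (z : Fin A × Fin S) : ℝ :=
  (alg.explore w h u) z.1 * (P (stateAfter x₁ h u) z.1) z.2

theorem episodeProb_eq_prod_stepProb (w : List (Episode S A H)) (e : Episode S A H) :
    alg.episodeProb x₁ P w e =
      ∏ h : Fin H, alg.stepProb x₁ P w h (fun i => e (Fin.castLE h.isLt.le i)) (e h) := by
  simp only [episodeProb, stepProb, stateAt_eq_stateAfter]

theorem sum_stepProb (w : List (Episode S A H)) (h : Fin H) (u : Fin h → Fin A × Fin S) :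
    ∑ z, alg.stepProb x₁ P w h u z = 1 := by
  simp only [stepProb, Fintype.sum_prod_type, ← Finset.mul_sum, stdSimplex.sum_eq_one, mul_one]

/-- If `U x` bounds the expectation of `f` on the next transition plus `U` at the next state,
for all actions, then `U x₁` bounds the expected sum of `f` over an episode,
however the algorithm explores. -/
theorem sum_episodeProb_mul_episodeSum_le (f : Fin S → Fin A → Fin S → ℝ) (U : Fin S → ℝ)
    (hU : ∀ x, 0 ≤ U x) (hfU : ∀ x a, ∑ y, (P x a) y * (f x a y + U y) ≤ U x)
    (w : List (Episode S A H)) :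
    ∑ e, alg.episodeProb x₁ P w e * episodeSum x₁ f e ≤ U x₁ := by
  let D : (h : ℕ) → (Fin h → Fin A × Fin S) → ℝ := fun h u =>
    (∑ i : Fin h, f (stateAfter x₁ i fun j => u (Fin.castLE i.isLt.le j)) (u i).1 (u i).2) +
      U (stateAfter x₁ h u)
  have hsnoc : ∀ (h : ℕ) (u : Fin h → Fin A × Fin S) (z : Fin A × Fin S),
      D (h + 1) (Fin.snoc (α := fun _ => Fin A × Fin S) u z) =
        (∑ i : Fin h, f (stateAfter x₁ i fun j => u (Fin.castLE i.isLt.le j)) (u i).1 (u i).2) +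
          (f (stateAfter x₁ h u) z.1 z.2 + U z.2) := by
    intro h u z
    simp only [D, stateAfter_succ_snoc, Fin.sum_univ_castSucc, Fin.snoc_last,
      Fin.snoc_castSucc (α := fun _ => Fin A × Fin S)]
    rw [add_assoc]
    congr 1
    · refine Finset.sum_congr rfl fun i _ => ?_
      congr 2
      funext j
      exact Fin.snoc_castSucc (α := fun _ => Fin A × Fin S) z u (Fin.castLE i.isLt.le j)
    · congr 3
      funext j
      exact Fin.snoc_castSucc (α := fun _ => Fin A × Fin S) z u j
  have hmain := sum_prod_mul_le (alg.stepProb x₁ P w)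
    (fun _ _ _ => mul_nonneg (stdSimplex.zero_le _ _) (stdSimplex.zero_le _ _)) D ?_
  · have h0 : D 0 Fin.elim0 = U x₁ := by simp [D, stateAfter]
    rw [h0] at hmain
    refine le_trans (Finset.sum_le_sum fun e _ => ?_) hmain
    rw [← episodeProb_eq_prod_stepProb]
    refine mul_le_mul_of_nonneg_left ?_ (alg.episodeProb_nonneg x₁ P w e)
    simp only [D, episodeSum, stateAt_eq_stateAfter]
    exact le_add_of_nonneg_right (hU _)
  · intro h u
    simp only [hsnoc, mul_add (alg.stepProb x₁ P w h u _)
      (∑ i : Fin (h : ℕ), f (stateAfter x₁ i fun j => u (Fin.castLE i.isLt.le j)) (u i).1 (u i).2),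
      Finset.sum_add_distrib, ← Finset.sum_mul, sum_stepProb, one_mul]
    refine add_le_add le_rfl ?_
    simp only [stepProb, Fintype.sum_prod_type, mul_assoc, ← Finset.mul_sum]
    calc ∑ a, (alg.explore w h u) a *
          ∑ y, (P (stateAfter x₁ h u) a) y * (f (stateAfter x₁ h u) a y + U y)
        ≤ ∑ a, (alg.explore w h u) a * U (stateAfter x₁ h u) :=
          Finset.sum_le_sum fun a _ => mul_le_mul_of_nonneg_left (hfU _ a) (stdSimplex.zero_le _ a)
      _ = U (stateAfter x₁ h u) := by rw [← Finset.sum_mul, stdSimplex.sum_eq_one, one_mul]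

theorem sum_episodeProb (w : List (Episode S A H)) : ∑ e, alg.episodeProb x₁ P w e = 1 := by
  have hnn : ∀ h u z, 0 ≤ alg.stepProb x₁ P w h u z :=
    fun _ _ _ => mul_nonneg (stdSimplex.zero_le _ _) (stdSimplex.zero_le _ _)
  have h1 := sum_prod_mul_le (alg.stepProb x₁ P w) hnn (fun _ _ => 1) fun h u => by
    simp only [mul_one, sum_stepProb, le_refl]
  have h2 := sum_prod_mul_le (alg.stepProb x₁ P w) hnn (fun _ _ => -1) fun h u => by
    simp only [mul_neg, mul_one, Finset.sum_neg_distrib, sum_stepProb, le_refl]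
  simp only [mul_neg, mul_one, Finset.sum_neg_distrib, ← episodeProb_eq_prod_stepProb] at h1 h2
  exact le_antisymm h1 (neg_le_neg_iff.1 h2)

/-- The likelihood ratio of two transition probabilities along the collected data. -/
theorem reachProb_eq_mul_exp {P₀ P₁ : Transition S A} {f : Fin S → Fin A → Fin S → ℝ}
    (hf : ∀ x a y, (P₁ x a) y = (P₀ x a) y * Real.exp (-f x a y)) (w : List (Episode S A H)) :
    alg.reachProb x₁ P₁ w = alg.reachProb x₁ P₀ w * Real.exp (-dataSum x₁ f w) := by
  induction w with
  | nil => simp [reachProb, dataSum]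
  | cons e w ih =>
    have he : alg.episodeProb x₁ P₁ w e =
        alg.episodeProb x₁ P₀ w e * Real.exp (-episodeSum x₁ f e) := by
      rw [episodeSum, ← Finset.sum_neg_distrib, Real.exp_sum, episodeProb, episodeProb,
        ← Finset.prod_mul_distrib]
      refine Finset.prod_congr rfl fun h _ => ?_
      rw [hf, mul_assoc]
    rw [reachProb, reachProb, ih, he, dataSum_cons, neg_add, Real.exp_add]
    ring

end Algorithm

end EpisodeData

/-! ### Sums over the data of a truncated exploration phase -/

section Words

variable (X : Type*) [Fintype X]

/-- The finite set of lists of length `k`. -/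
noncomputable def listsOfLength : ℕ → Finset (List X)
  | 0 => {[]}
  | k + 1 => ((Finset.univ : Finset X) ×ˢ listsOfLength k).map
      ⟨fun z => z.1 :: z.2, fun a b h => by
        obtain ⟨h1, h2⟩ := List.cons.inj h
        exact Prod.ext h1 h2⟩

variable {X}

theorem mem_listsOfLength {k : ℕ} {w : List X} : w ∈ listsOfLength X k ↔ w.length = k := by
  induction k generalizing w with
  | zero => simp [listsOfLength]
  | succ k ih =>
    cases w with
    | nil => simp [listsOfLength]
    | cons e w =>
      simp only [listsOfLength, Finset.mem_map, Finset.mem_product, Finset.mem_univ, true_and,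
        Prod.exists, ih, List.length_cons, Nat.add_right_cancel_iff]
      exact ⟨fun ⟨_, _, hb, h⟩ => (List.cons.inj h).2 ▸ hb, fun h => ⟨e, w, h, rfl⟩⟩

theorem sum_listsOfLength_succ (k : ℕ) (F : List X → ℝ) :
    ∑ w ∈ listsOfLength X (k + 1), F w = ∑ w ∈ listsOfLength X k, ∑ e, F (e :: w) := by
  rw [listsOfLength, Finset.sum_map, Finset.sum_product_right]
  rfl

end Words

namespace Algorithm

variable {S A H : ℕ} (alg : Algorithm S A H) (x₁ : Fin S) (P : Transition S A)

/-- The probability `ℙ(K > k)` as a real number. -/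
noncomputable def realTail (k : ℕ) : ℝ :=
  ∑ w ∈ listsOfLength (Episode S A H) k, alg.reachProb x₁ P w * (1 - (alg.halt w : ℝ))

theorem realTail_nonneg (k : ℕ) : 0 ≤ alg.realTail x₁ P k :=
  Finset.sum_nonneg fun w _ =>
    mul_nonneg (alg.reachProb_nonneg x₁ P w) (sub_nonneg.2 (alg.halt w).2.2)

theorem tailProb_eq_ofReal (k : ℕ) :
    alg.tailProb x₁ P k = ENNReal.ofReal (alg.realTail x₁ P k) := by
  rw [tailProb, realTail, ENNReal.ofReal_sum_of_nonneg fun w _ =>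
    mul_nonneg (alg.reachProb_nonneg x₁ P w) (sub_nonneg.2 (alg.halt w).2.2)]
  rw [tsum_eq_sum (s := listsOfLength (Episode S A H) k)]
  · exact Finset.sum_congr rfl fun w hw => if_pos (mem_listsOfLength.1 hw)
  · exact fun w hw => if_neg fun h => hw (mem_listsOfLength.2 h)

/-- The expectation of `φ` at the data collected in the first `min K k` episodes. -/
noncomputable def truncExp (k : ℕ) (φ : List (Episode S A H) → ℝ) : ℝ :=
  (∑ j ∈ Finset.range k, ∑ w ∈ listsOfLength (Episode S A H) j, alg.haltProb x₁ P w * φ w) +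
    ∑ w ∈ listsOfLength (Episode S A H) k, alg.reachProb x₁ P w * φ w

theorem truncExp_succ (k : ℕ) (φ : List (Episode S A H) → ℝ) :
    alg.truncExp x₁ P (k + 1) φ = alg.truncExp x₁ P k φ +
      ∑ w ∈ listsOfLength (Episode S A H) k, alg.reachProb x₁ P w * (1 - (alg.halt w : ℝ)) *
        ∑ e, alg.episodeProb x₁ P w e * (φ (e :: w) - φ w) := by
  rw [truncExp, truncExp, Finset.sum_range_succ, sum_listsOfLength_succ, add_assoc, add_assoc]
  congr 1
  rw [← Finset.sum_add_distrib, ← Finset.sum_add_distrib]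
  refine Finset.sum_congr rfl fun w _ => ?_
  simp only [mul_sub, Finset.sum_sub_distrib, ← Finset.sum_mul, sum_episodeProb, one_mul,
    reachProb, haltProb, Finset.mul_sum, ← mul_assoc]
  ring

theorem truncExp_one (k : ℕ) : alg.truncExp x₁ P k (fun _ => 1) = 1 := by
  induction k with
  | zero => simp [truncExp, listsOfLength, reachProb]
  | succ k ih => simp [truncExp_succ, ih]

theorem truncExp_finsetSum {ι : Type*} (s : Finset ι) (k : ℕ)
    (φ : ι → List (Episode S A H) → ℝ) :
    ∑ i ∈ s, alg.truncExp x₁ P k (φ i) = alg.truncExp x₁ P k fun w => ∑ i ∈ s, φ i w := by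
  simp only [truncExp, Finset.sum_add_distrib, Finset.mul_sum]
  congr 1
  · rw [Finset.sum_comm]
    exact Finset.sum_congr rfl fun j _ => Finset.sum_comm
  · exact Finset.sum_comm

/-- A one-sided form of Wald's identity. -/
theorem truncExp_dataSum_le (f : Fin S → Fin A → Fin S → ℝ) {c : ℝ}
    (hc : ∀ w, ∑ e, alg.episodeProb x₁ P w e * episodeSum x₁ f e ≤ c) (k : ℕ) :
    alg.truncExp x₁ P k (dataSum x₁ f) ≤ c * ∑ j ∈ Finset.range k, alg.realTail x₁ P j := by
  induction k with
  | zero => simp [truncExp, listsOfLength, reachProb, dataSum]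
  | succ k ih =>
    rw [truncExp_succ, Finset.sum_range_succ, mul_add]
    refine add_le_add ih ?_
    rw [realTail, Finset.mul_sum]
    refine Finset.sum_le_sum fun w _ => ?_
    rw [mul_comm c]
    refine mul_le_mul_of_nonneg_left ?_
      (mul_nonneg (alg.reachProb_nonneg x₁ P w) (sub_nonneg.2 (alg.halt w).2.2))
    simpa only [dataSum_cons, add_sub_cancel_right] using hc w

theorem sum_haltProb_eq (k : ℕ) :
    ∑ j ∈ Finset.range (k + 1), ∑ w ∈ listsOfLength (Episode S A H) j, alg.haltProb x₁ P w =
      1 - alg.realTail x₁ P k := by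
  have h := alg.truncExp_one x₁ P (k + 1)
  simp only [truncExp, mul_one, sum_listsOfLength_succ, reachProb, ← Finset.mul_sum,
    sum_episodeProb] at h
  rw [realTail]
  linarith

/-- The change of measure between two transition probabilities: if the weight `g` has mass `a`
under `P₀` and mass `b` under `P₁` over the halted runs of at most `k` episodes, then the
expected log-likelihood ratio is at least `c * a - exp c * b` for every `c`. This is the
variational form of the data processing inequality for the relative entropy. -/
theorem le_truncExp_dataSum {P₀ P₁ : Transition S A} {f : Fin S → Fin A → Fin S → ℝ}
    (hf : ∀ x a y, (P₁ x a) y = (P₀ x a) y * Real.exp (-f x a y))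
    (g : List (Episode S A H) → ℝ) (hg0 : ∀ w, 0 ≤ g w) (hg1 : ∀ w, g w ≤ 1) (c : ℝ) (k : ℕ) :
    c * (∑ j ∈ Finset.range k, ∑ w ∈ listsOfLength (Episode S A H) j,
        alg.haltProb x₁ P₀ w * g w) -
      Real.exp c * (∑ j ∈ Finset.range k, ∑ w ∈ listsOfLength (Episode S A H) j,
        alg.haltProb x₁ P₁ w * g w) ≤
    alg.truncExp x₁ P₀ k (dataSum x₁ f) := by
  have hpt : ∀ t γ : ℝ, 0 ≤ γ → γ ≤ 1 →
      1 - Real.exp (-t) + c * γ - Real.exp c * (Real.exp (-t) * γ) ≤ t := by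
    intro t γ h0 h1
    have e1 := Real.add_one_le_exp (-t)
    have e2 := Real.add_one_le_exp (c - t)
    rw [sub_eq_add_neg, Real.exp_add] at e2
    have e3 := Real.exp_pos (-t)
    nlinarith [mul_nonneg h0 (sub_nonneg.2 e2), mul_nonneg (sub_nonneg.2 h1) (sub_nonneg.2 e1),
      mul_nonneg h0 e3.le]
  have hhalt : ∀ w, alg.haltProb x₁ P₁ w =
      alg.haltProb x₁ P₀ w * Real.exp (-dataSum x₁ f w) := by
    intro w
    rw [haltProb, haltProb, alg.reachProb_eq_mul_exp x₁ hf]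
    ring
  have h0 := alg.truncExp_one x₁ P₀ k
  have h1 := alg.truncExp_one x₁ P₁ k
  simp only [truncExp, mul_one] at h0 h1
  have hA : ∑ j ∈ Finset.range k, ∑ w ∈ listsOfLength (Episode S A H) j,
      (alg.haltProb x₁ P₀ w - alg.haltProb x₁ P₁ w + c * (alg.haltProb x₁ P₀ w * g w) -
        Real.exp c * (alg.haltProb x₁ P₁ w * g w)) ≤
      ∑ j ∈ Finset.range k, ∑ w ∈ listsOfLength (Episode S A H) j,
        alg.haltProb x₁ P₀ w * dataSum x₁ f w := by
    refine Finset.sum_le_sum fun j _ => Finset.sum_le_sum fun w _ => ?_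
    rw [hhalt w]
    refine le_trans (le_of_eq ?_) (mul_le_mul_of_nonneg_left
      (hpt (dataSum x₁ f w) (g w) (hg0 w) (hg1 w)) (alg.haltProb_nonneg x₁ P₀ w))
    ring
  have hB : ∑ w ∈ listsOfLength (Episode S A H) k,
      (alg.reachProb x₁ P₀ w - alg.reachProb x₁ P₁ w) ≤
      ∑ w ∈ listsOfLength (Episode S A H) k, alg.reachProb x₁ P₀ w * dataSum x₁ f w := by
    refine Finset.sum_le_sum fun w _ => ?_
    rw [alg.reachProb_eq_mul_exp x₁ hf]
    refine le_trans (le_of_eq ?_) (mul_le_mul_of_nonneg_left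
      (hpt (dataSum x₁ f w) 0 le_rfl zero_le_one) (alg.reachProb_nonneg x₁ P₀ w))
    ring
  simp only [Finset.sum_sub_distrib, Finset.sum_add_distrib, ← Finset.mul_sum] at hA hB
  rw [truncExp]
  linarith

end Algorithm

/-! ### Testing two transition probabilities -/

namespace Algorithm

variable {S A H : ℕ} (alg : Algorithm S A H) (x₁ : Fin S)

theorem sum_haltProb_mul_plan_le {P : Transition S A} {r : Reward S A H} {ε δ : ℝ} (hδ : 0 ≤ δ)
    (herr : alg.errorProb x₁ P r ε < ENNReal.ofReal δ) (k : ℕ) :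
    ∑ j ∈ Finset.range k, ∑ w ∈ listsOfLength (Episode S A H) j, alg.haltProb x₁ P w *
      ((alg.plan w r : Measure (Policy S A H))
        {π | ε < optValue P r 0 x₁ - policyValue P r π 0 x₁}).toReal ≤ δ := by
  classical
  have hdisj : Set.PairwiseDisjoint ((Finset.range k : Finset ℕ) : Set ℕ)
      (listsOfLength (Episode S A H)) := by
    intro i _ j _ hij
    rw [Function.onFun, Finset.disjoint_left]
    exact fun w hi hj => hij ((mem_listsOfLength.1 hi).symm.trans (mem_listsOfLength.1 hj))
  rw [← Finset.sum_biUnion hdisj, ← ENNReal.ofReal_le_ofReal_iff hδ]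
  refine le_trans ?_ herr.le
  rw [ENNReal.ofReal_sum_of_nonneg fun w _ =>
    mul_nonneg (alg.haltProb_nonneg x₁ P w) ENNReal.toReal_nonneg, errorProb]
  refine le_trans (le_of_eq (Finset.sum_congr rfl fun w _ => ?_)) (ENNReal.sum_le_tsum _)
  rw [ENNReal.ofReal_mul (alg.haltProb_nonneg x₁ P w), ENNReal.ofReal_toReal (measure_ne_top _ _)]

/-- If no policy is `ε`-optimal for both `P₀` and `P₁`, then an algorithm that errs with
probability less than `δ` on each of them has to collect, under `P₀`, a log-likelihood ratio of
order `log (1 / δ)` on average. -/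
theorem half_log_le_truncExp {P₀ P₁ : Transition S A} {f : Fin S → Fin A → Fin S → ℝ}
    (hf : ∀ x a y, (P₁ x a) y = (P₀ x a) y * Real.exp (-f x a y))
    {r : Reward S A H} {ε δ : ℝ} (hδ : 0 < δ) (hδ8 : δ < 1 / 8)
    (herr₀ : alg.errorProb x₁ P₀ r ε < ENNReal.ofReal δ)
    (herr₁ : alg.errorProb x₁ P₁ r ε < ENNReal.ofReal δ)
    (hsep : ∀ π : Policy S A H, ε < optValue P₀ r 0 x₁ - policyValue P₀ r π 0 x₁ ∨
      ε < optValue P₁ r 0 x₁ - policyValue P₁ r π 0 x₁)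
    {k : ℕ} (hk : alg.realTail x₁ P₀ k ≤ 1 / 4) :
    Real.log (1 / 8 / δ) / 2 ≤ alg.truncExp x₁ P₀ (k + 1) (dataSum x₁ f) := by
  let B₀ : Set (Policy S A H) := {π | ε < optValue P₀ r 0 x₁ - policyValue P₀ r π 0 x₁}
  let B₁ : Set (Policy S A H) := {π | ε < optValue P₁ r 0 x₁ - policyValue P₁ r π 0 x₁}
  let g₀ : List (Episode S A H) → ℝ := fun w => ((alg.plan w r : Measure (Policy S A H)) B₀).toReal
  let g₁ : List (Episode S A H) → ℝ := fun w => ((alg.plan w r : Measure (Policy S A H)) B₁).toReal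
  have hcover : ∀ w, 1 ≤ g₀ w + g₁ w := by
    intro w
    have huniv : B₀ ∪ B₁ = Set.univ := Set.eq_univ_of_forall hsep
    have hle := measure_union_le (μ := (alg.plan w r : Measure (Policy S A H))) B₀ B₁
    rw [huniv, measure_univ] at hle
    rw [← ENNReal.toReal_add (measure_ne_top _ _) (measure_ne_top _ _), ← ENNReal.toReal_one]
    exact ENNReal.toReal_mono (ENNReal.add_ne_top.2 ⟨measure_ne_top _ _, measure_ne_top _ _⟩) hle
  have hg1 : ∀ w, g₁ w ≤ 1 := fun w =>
    (ENNReal.toReal_mono ENNReal.one_ne_top prob_le_one).trans_eq ENNReal.toReal_one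
  have hE₀ := alg.sum_haltProb_mul_plan_le x₁ hδ.le herr₀ (k + 1)
  have hE₁ := alg.sum_haltProb_mul_plan_le x₁ hδ.le herr₁ (k + 1)
  have hmass : 1 / 2 ≤ ∑ j ∈ Finset.range (k + 1), ∑ w ∈ listsOfLength (Episode S A H) j,
      alg.haltProb x₁ P₀ w * g₁ w := by
    have hsum : ∑ j ∈ Finset.range (k + 1), ∑ w ∈ listsOfLength (Episode S A H) j,
        (alg.haltProb x₁ P₀ w - alg.haltProb x₁ P₀ w * g₀ w) ≤
        ∑ j ∈ Finset.range (k + 1), ∑ w ∈ listsOfLength (Episode S A H) j,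
          alg.haltProb x₁ P₀ w * g₁ w :=
      Finset.sum_le_sum fun j _ => Finset.sum_le_sum fun w _ => by
        nlinarith [alg.haltProb_nonneg x₁ P₀ w, hcover w]
    simp only [Finset.sum_sub_distrib, sum_haltProb_eq] at hsum
    linarith
  -- With `exp c = 1 / (4 δ)` the second term of the change of measure is at most `1 / 4`.
  have hinfo := alg.le_truncExp_dataSum x₁ hf g₁ (fun _ => ENNReal.toReal_nonneg) hg1
    (Real.log (1 / 4 / δ)) (k + 1)
  rw [Real.exp_log (by positivity)] at hinfo
  have hlog : Real.log (1 / 4 / δ) = Real.log (1 / 8 / δ) + Real.log 2 := by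
    rw [← Real.log_mul (by positivity) two_ne_zero]
    congr 1
    ring
  have hlog8 : 0 ≤ Real.log (1 / 8 / δ) :=
    Real.log_nonneg ((one_le_div hδ).2 hδ8.le)
  have hlog2 := Real.log_two_gt_d9
  have hb : 1 / 4 / δ * (∑ j ∈ Finset.range (k + 1), ∑ w ∈ listsOfLength (Episode S A H) j,
      alg.haltProb x₁ P₁ w * g₁ w) ≤ 1 / 4 := by
    refine (mul_le_mul_of_nonneg_left hE₁ (by positivity)).trans_eq ?_
    field_simp
  have ha := mul_le_mul_of_nonneg_left hmass
    (show (0 : ℝ) ≤ Real.log (1 / 4 / δ) by linarith)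
  linarith

/-- The sum of the tails up to `k` is bounded by `𝔼[K]`. -/
theorem ofReal_sum_realTail_le (P : Transition S A) (k : ℕ) :
    ENNReal.ofReal (∑ j ∈ Finset.range k, alg.realTail x₁ P j) ≤
      alg.expectedEpisodes x₁ P := by
  rw [ENNReal.ofReal_sum_of_nonneg fun j _ => alg.realTail_nonneg x₁ P j]
  simp only [← tailProb_eq_ofReal]
  exact ENNReal.sum_le_tsum _

theorem exists_realTail_le (P : Transition S A) (hfin : alg.expectedEpisodes x₁ P ≠ ⊤) {η : ℝ}
    (hη : 0 < η) : ∃ k, alg.realTail x₁ P k ≤ η := by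
  have ht := ENNReal.tendsto_atTop_zero_of_tsum_ne_top hfin
  obtain ⟨k, hk⟩ := ((ENNReal.tendsto_nhds_zero.1 ht) _ (ENNReal.ofReal_pos.2 hη)).exists
  rw [tailProb_eq_ofReal, ENNReal.ofReal_le_ofReal_iff hη.le] at hk
  exact ⟨k, hk⟩

/-- The expected number of episodes that is needed to test a baseline `P₀` against every
alternative `P₁ i`, if an episode reveals in total at most `c` about them. -/
theorem le_expectedEpisodes_of_alternatives {ι : Type*} (s : Finset ι) {P₀ : Transition S A}
    {P₁ : ι → Transition S A} {f : ι → Fin S → Fin A → Fin S → ℝ}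
    (hf : ∀ i ∈ s, ∀ x a y, (P₁ i x a) y = (P₀ x a) y * Real.exp (-f i x a y))
    {r : Reward S A H} {ε δ : ℝ} (hδ : 0 < δ) (hδ8 : δ < 1 / 8)
    (herr₀ : alg.errorProb x₁ P₀ r ε < ENNReal.ofReal δ)
    (herr₁ : ∀ i ∈ s, alg.errorProb x₁ (P₁ i) r ε < ENNReal.ofReal δ)
    (hsep : ∀ i ∈ s, ∀ π : Policy S A H, ε < optValue P₀ r 0 x₁ - policyValue P₀ r π 0 x₁ ∨
      ε < optValue (P₁ i) r 0 x₁ - policyValue (P₁ i) r π 0 x₁)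
    {c : ℝ} (hc : 0 < c) (U : Fin S → ℝ) (hU : ∀ x, 0 ≤ U x) (hUc : U x₁ ≤ c)
    (hfU : ∀ x a, ∑ y, (P₀ x a) y * ((∑ i ∈ s, f i x a y) + U y) ≤ U x) :
    ENNReal.ofReal (s.card * (Real.log (1 / 8 / δ) / 2) / c) ≤ alg.expectedEpisodes x₁ P₀ := by
  by_cases hfin : alg.expectedEpisodes x₁ P₀ = ⊤
  · rw [hfin]
    exact le_top
  obtain ⟨k, hk⟩ := alg.exists_realTail_le x₁ P₀ hfin (show (0 : ℝ) < 1 / 4 by norm_num)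
  refine le_trans (ENNReal.ofReal_le_ofReal ?_) (alg.ofReal_sum_realTail_le x₁ P₀ (k + 1))
  rw [div_le_iff₀' hc]
  have hlow := Finset.sum_le_sum fun i hi =>
    alg.half_log_le_truncExp x₁ (hf i hi) hδ hδ8 herr₀ (herr₁ i hi) (hsep i hi) hk
  rw [Finset.sum_const, nsmul_eq_mul, truncExp_finsetSum] at hlow
  simp only [dataSum_finsetSum] at hlow
  exact hlow.trans (alg.truncExp_dataSum_le x₁ P₀ _ (fun w =>
    (alg.sum_episodeProb_mul_episodeSum_le x₁ P₀ _ U hU hfU w).trans hUc) (k + 1))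

end Algorithm

/-! ### The hard instances -/

/-- The law on two states that gives mass `t` to `y` and mass `1 - t` to `z`. -/
noncomputable def twoPoint {S : ℕ} (t : unitInterval) (y z : Fin S) : stdSimplex ℝ (Fin S) :=
  ⟨fun x => t * Pi.single (M := fun _ => ℝ) y 1 x + (1 - t) * Pi.single (M := fun _ => ℝ) z 1 x,
    convex_stdSimplex ℝ (Fin S) (single_mem_stdSimplex ℝ y) (single_mem_stdSimplex ℝ z)
      t.2.1 (sub_nonneg.2 t.2.2) (by ring)⟩

theorem twoPoint_apply {S : ℕ} (t : unitInterval) (y z x : Fin S) :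
    (twoPoint t y z) x =
      t * Pi.single (M := fun _ => ℝ) y 1 x + (1 - t) * Pi.single (M := fun _ => ℝ) z 1 x := rfl

theorem sum_twoPoint_mul {S : ℕ} (t : unitInterval) (y z : Fin S) (F : Fin S → ℝ) :
    ∑ x, (twoPoint t y z) x * F x = t * F y + (1 - t) * F z := by
  simp only [twoPoint_apply, add_mul, Finset.sum_add_distrib, mul_assoc, ← Finset.mul_sum,
    Pi.single_apply, ite_mul, one_mul, zero_mul, Finset.sum_ite_eq', Finset.mem_univ, if_true]

/-- `x` can be reached from `root` in exactly `t` moves along `child` that start outside `leaf`. -/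
def ReachIn {S A : ℕ} (root : Fin S) (leaf : Finset (Fin S)) (child : Fin S → Fin A → Fin S) :
    ℕ → Fin S → Prop
  | 0, x => x = root
  | t + 1, x => ∃ y a, y ∉ leaf ∧ ReachIn root leaf child t y ∧ child y a = x

/-- The layout shared by the hard instances. From `start` one enters `root` with probability
`entry` and the absorbing state `bad` otherwise. All states apart from `start`, `good` and `bad`
are nodes. At an inner node the action selects the next node. At a leaf every action leads to
`good` or `bad`, both absorbing: to `good` with probability `1 / 2 + Δ` for the action `safe`, with
probability `1 / 2 + 2 * Δ` at the arms of the instance, and with probability `1 / 2` otherwise.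
The state `good` pays from step `delay` on, so that the time at which it is reached does not
matter if a leaf is visited before step `delay`. -/
structure Maze (S A H : ℕ) where
  start : Fin S
  good : Fin S
  bad : Fin S
  root : Fin S
  safe : Fin A
  leaf : Finset (Fin S)
  child : Fin S → Fin A → Fin S
  delay : ℕ
  entry : unitInterval
  Δ : ℝ
  good_ne_start : good ≠ start
  bad_ne_start : bad ≠ start
  good_ne_bad : good ≠ bad
  node_root : root ≠ start ∧ root ≠ good ∧ root ≠ bad
  node_child : ∀ x a, child x a ≠ start ∧ child x a ≠ good ∧ child x a ≠ bad
  node_leaf : ∀ x ∈ leaf, x ≠ start ∧ x ≠ good ∧ x ≠ bad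
  two_le_delay : 2 ≤ delay
  delay_lt : delay < H
  Δ_pos : 0 < Δ
  Δ_mul_le : Δ * ((H : ℝ) - delay) ≤ 1 / 6
  reach : ∀ x ∈ leaf, ∃ t, t + 2 ≤ delay ∧ ReachIn root leaf child t x

namespace Maze

variable {S A H : ℕ} (M : Maze S A H)

/-- The states other than `start`, `good` and `bad`. -/
def IsNode (x : Fin S) : Prop := x ≠ M.start ∧ x ≠ M.good ∧ x ≠ M.bad

/-- The number of steps in which `good` pays. -/
def payoff : ℝ := (H : ℝ) - M.delay

/-- The arms that can be made special. -/
def arms : Finset (Fin S × Fin A) := M.leaf ×ˢ Finset.univ.erase M.safe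

theorem mem_arms {z : Fin S × Fin A} : z ∈ M.arms ↔ z.1 ∈ M.leaf ∧ z.2 ≠ M.safe := by
  simp [arms]

theorem card_arms : M.arms.card = M.leaf.card * (A - 1) := by
  simp [arms, Finset.card_product]

theorem one_le_payoff : 1 ≤ M.payoff := by
  have : ((M.delay + 1 : ℕ) : ℝ) ≤ H := Nat.cast_le.2 M.delay_lt
  push_cast at this
  rw [payoff]
  linarith

theorem Δ_mul_payoff_pos : 0 < M.Δ * M.payoff :=
  mul_pos M.Δ_pos (zero_lt_one.trans_le M.one_le_payoff)

theorem Δ_mul_payoff_le : M.Δ * M.payoff ≤ 1 / 6 := M.Δ_mul_le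

theorem Δ_le : M.Δ ≤ 1 / 6 :=
  (le_mul_of_one_le_right M.Δ_pos.le M.one_le_payoff).trans M.Δ_mul_payoff_le

/-- The probability of `good` at the leaf `x` under the action `a`, if the arms in `B` are
special. -/
noncomputable def rate (B : Finset (Fin S × Fin A)) (x : Fin S) (a : Fin A) : ℝ :=
  if (x, a) ∈ B then 1 / 2 + 2 * M.Δ else if a = M.safe then 1 / 2 + M.Δ else 1 / 2

theorem rate_mem (B : Finset (Fin S × Fin A)) (x : Fin S) (a : Fin A) :
    M.rate B x a ∈ unitInterval := by
  have h1 := M.Δ_pos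
  have h2 := M.Δ_le
  rw [rate]
  split_ifs <;> constructor <;> linarith

theorem rate_safe {B : Finset (Fin S × Fin A)} (hB : B ⊆ M.arms) (x : Fin S) :
    M.rate B x M.safe = 1 / 2 + M.Δ := by
  rw [rate, if_neg fun h => (M.mem_arms.1 (hB h)).2 rfl, if_pos rfl]

theorem rate_of_ne_safe {B : Finset (Fin S × Fin A)} (x : Fin S) {a : Fin A} (ha : a ≠ M.safe) :
    M.rate B x a = 1 / 2 + 2 * M.Δ ∨ M.rate B x a = 1 / 2 := by
  rw [rate]
  split_ifs <;> simp

/-- The transition probability of the instance in which the arms in `B` are special. -/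
noncomputable def transition (B : Finset (Fin S × Fin A)) : Transition S A := fun x a =>
  if x = M.start then twoPoint M.entry M.root M.bad
  else if x = M.good then twoPoint 1 M.good M.bad
  else if x = M.bad then twoPoint 0 M.good M.bad
  else if x ∈ M.leaf then twoPoint ⟨M.rate B x a, M.rate_mem B x a⟩ M.good M.bad
  else twoPoint 1 (M.child x a) M.bad

section Transition

variable (B : Finset (Fin S × Fin A)) (a : Fin A) (F : Fin S → ℝ)

theorem sum_transition_start : ∑ y, (M.transition B M.start a) y * F y =
    M.entry * F M.root + (1 - M.entry) * F M.bad := by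
  rw [transition, if_pos rfl, sum_twoPoint_mul]

theorem sum_transition_good : ∑ y, (M.transition B M.good a) y * F y = F M.good := by
  rw [transition, if_neg M.good_ne_start, if_pos rfl, sum_twoPoint_mul]
  simp

theorem sum_transition_bad : ∑ y, (M.transition B M.bad a) y * F y = F M.bad := by
  rw [transition, if_neg M.bad_ne_start, if_neg M.good_ne_bad.symm, if_pos rfl, sum_twoPoint_mul]
  simp

variable {x : Fin S}

theorem transition_leaf (hx : x ∈ M.leaf) : M.transition B x a =
    twoPoint ⟨M.rate B x a, M.rate_mem B x a⟩ M.good M.bad := by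
  obtain ⟨h1, h2, h3⟩ := M.node_leaf x hx
  rw [transition, if_neg h1, if_neg h2, if_neg h3, if_pos hx]

theorem sum_transition_leaf (hx : x ∈ M.leaf) : ∑ y, (M.transition B x a) y * F y =
    M.rate B x a * F M.good + (1 - M.rate B x a) * F M.bad := by
  rw [transition_leaf M B a hx, sum_twoPoint_mul]

theorem sum_transition_inner (hx : M.IsNode x) (hl : x ∉ M.leaf) :
    ∑ y, (M.transition B x a) y * F y = F (M.child x a) := by
  rw [transition, if_neg hx.1, if_neg hx.2.1, if_neg hx.2.2, if_neg hl, sum_twoPoint_mul]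
  simp

end Transition

theorem safeProb_mem : 1 / 2 + M.Δ ∈ unitInterval := by
  have h1 := M.Δ_pos
  have h2 := M.Δ_le
  constructor <;> linarith

/-- The reward function. Nothing is paid before step `delay`; later the nodes pay for the
action `safe` such that each node is worth `1 / 2 + Δ` per remaining step. This keeps all
positive gaps of the steps in which little is left to gain away from zero. -/
noncomputable def reward : Reward S A H := fun h x a =>
  if (h : ℕ) < M.delay then 0
  else if x = M.good then 1
  else if x = M.start ∨ x = M.bad then 0
  else if x ∈ M.leaf ∧ a ≠ M.safe then 0
  else ⟨1 / 2 + M.Δ, M.safeProb_mem⟩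

section Reward

variable {h : Fin H} (x : Fin S) (a : Fin A)

theorem reward_early (hh : (h : ℕ) < M.delay) : (M.reward h x a : ℝ) = 0 := by
  rw [reward, if_pos hh]
  rfl

theorem reward_bad : (M.reward h M.bad a : ℝ) = 0 := by
  rw [reward, if_neg M.good_ne_bad.symm]
  simp

theorem reward_good (hh : M.delay ≤ (h : ℕ)) : (M.reward h M.good a : ℝ) = 1 := by
  rw [reward, if_neg hh.not_gt, if_pos rfl]
  rfl

theorem reward_start : (M.reward h M.start a : ℝ) = 0 := by
  rw [reward, if_neg M.good_ne_start.symm]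
  simp

variable {x a}

theorem reward_leaf_late (hh : M.delay ≤ (h : ℕ)) (hx : x ∈ M.leaf) (ha : a ≠ M.safe) :
    (M.reward h x a : ℝ) = 0 := by
  obtain ⟨h1, h2, h3⟩ := M.node_leaf x hx
  rw [reward, if_neg hh.not_gt, if_neg h2, if_neg (by tauto), if_pos ⟨hx, ha⟩]
  rfl

theorem reward_node_late (hh : M.delay ≤ (h : ℕ)) (hx : M.IsNode x)
    (ha : x ∉ M.leaf ∨ a = M.safe) : (M.reward h x a : ℝ) = 1 / 2 + M.Δ := by
  obtain ⟨h1, h2, h3⟩ := hx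
  rw [reward, if_neg hh.not_gt, if_neg h2, if_neg (by tauto), if_neg (by tauto)]

end Reward

/-! ### Values and gaps of the hard instances -/

section Values

variable (B : Finset (Fin S × Fin A))

theorem policyValue_bad (π : Policy S A H) (h : ℕ) :
    policyValue (M.transition B) M.reward π h M.bad = 0 := by
  rcases lt_or_ge h H with hh | hh
  · refine policyValue_eq_of_forall_policyQ hh fun a => ?_
    rw [policyQ, reward_bad, sum_transition_bad, policyValue_bad π (h + 1), add_zero]
  · exact policyValue_of_le hh _
termination_by H - h

theorem policyValue_good (π : Policy S A H) (h : ℕ) (hH : h ≤ H) :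
    policyValue (M.transition B) M.reward π h M.good = (H : ℝ) - (max h M.delay : ℕ) := by
  have hT := M.delay_lt
  rcases lt_or_ge h H with hh | hh
  · refine policyValue_eq_of_forall_policyQ hh fun a => ?_
    rw [policyQ, sum_transition_good, policyValue_good π (h + 1) hh]
    rcases lt_or_ge h M.delay with hd | hd
    · rw [M.reward_early _ _ hd, max_eq_right hd.le, max_eq_right (Nat.succ_le_of_lt hd), zero_add]
    · rw [M.reward_good _ hd, max_eq_left hd, max_eq_left (Nat.le_succ_of_le hd)]
      push_cast
      ring
  · obtain rfl := le_antisymm hH hh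
    rw [policyValue_of_le hh, max_eq_left hT.le, sub_self]
termination_by H - h

/-- The optimal value at step `h`. -/
noncomputable def value (h : ℕ) (x : Fin S) : ℝ := optValue (M.transition B) M.reward h x

theorem nonempty_action (M : Maze S A H) : Nonempty (Fin A) := ⟨M.safe⟩

theorem value_bad (h : ℕ) : M.value B h M.bad = 0 := by
  have := M.nonempty_action
  obtain ⟨π, hπ⟩ := exists_policyValue_eq_optValue (M.transition B) M.reward
  rw [value, ← hπ, policyValue_bad]

theorem value_good (h : ℕ) (hH : h ≤ H) :
    M.value B h M.good = (H : ℝ) - (max h M.delay : ℕ) := by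
  have := M.nonempty_action
  obtain ⟨π, hπ⟩ := exists_policyValue_eq_optValue (M.transition B) M.reward
  rw [value, ← hπ, policyValue_good M B π h hH]

variable (h : Fin H) (a : Fin A)

theorem optQ_start : optQ (M.transition B) M.reward h M.start a =
    M.entry * M.value B (h + 1) M.root := by
  have := M.nonempty_action
  rw [optQ_eq, reward_start, sum_transition_start]
  have := M.value_bad B (h + 1)
  rw [value] at this
  rw [this, mul_zero, add_zero, zero_add, value]

theorem optQ_leaf {x : Fin S} (hx : x ∈ M.leaf) : optQ (M.transition B) M.reward h x a =
    M.reward h x a + M.rate B x a * ((H : ℝ) - (max (h + 1) M.delay : ℕ)) := by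
  have := M.nonempty_action
  rw [optQ_eq, sum_transition_leaf M B a _ hx]
  have h1 := M.value_bad B (h + 1)
  have h2 := M.value_good B (h + 1) h.isLt
  rw [value] at h1 h2
  rw [h1, h2, mul_zero, add_zero]

theorem optQ_leaf_early {x : Fin S} (hx : x ∈ M.leaf) (hh : (h : ℕ) < M.delay) :
    optQ (M.transition B) M.reward h x a = M.rate B x a * M.payoff := by
  rw [optQ_leaf M B h a hx, M.reward_early _ _ hh, max_eq_right (Nat.succ_le_of_lt hh), zero_add,
    payoff]

theorem optQ_leaf_late {x : Fin S} (hx : x ∈ M.leaf) (hh : M.delay ≤ (h : ℕ)) :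
    optQ (M.transition B) M.reward h x a =
      M.reward h x a + M.rate B x a * ((H : ℝ) - h - 1) := by
  rw [optQ_leaf M B h a hx, max_eq_left (Nat.le_succ_of_le hh)]
  push_cast
  ring

theorem optQ_inner {x : Fin S} (hx : M.IsNode x) (hl : x ∉ M.leaf) :
    optQ (M.transition B) M.reward h x a = M.reward h x a + M.value B (h + 1) (M.child x a) := by
  have := M.nonempty_action
  rw [optQ_eq, sum_transition_inner M B a _ hx hl, value]

variable {B}

/-- In the late steps, the action `safe` has an advantage of at least `1 / 3` at a leaf. -/
theorem optQ_leaf_late_le {h : Fin H} {a : Fin A} {x : Fin S} (hx : x ∈ M.leaf)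
    (hh : M.delay ≤ (h : ℕ)) (ha : a ≠ M.safe) :
    optQ (M.transition B) M.reward h x a ≤ (1 / 2 + M.Δ) * ((H : ℝ) - h) - 1 / 3 := by
  rw [optQ_leaf_late M B h a hx hh, reward_leaf_late M hh hx ha, zero_add]
  have hH : ((h + 1 : ℕ) : ℝ) ≤ H := Nat.cast_le.2 h.isLt
  have hd : (M.delay : ℝ) ≤ (h : ℕ) := Nat.cast_le.2 hh
  push_cast at hH
  have h1 := M.Δ_pos
  have h2 : M.Δ * ((H : ℝ) - h - 1) ≤ 1 / 6 :=
    (mul_le_mul_of_nonneg_left (by linarith) h1.le).trans M.Δ_mul_le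
  rcases M.rate_of_ne_safe (B := B) x ha with hr | hr <;> rw [hr] <;> nlinarith

theorem optQ_leaf_late_safe (hB : B ⊆ M.arms) {h : Fin H} {x : Fin S} (hx : x ∈ M.leaf)
    (hh : M.delay ≤ (h : ℕ)) :
    optQ (M.transition B) M.reward h x M.safe = (1 / 2 + M.Δ) * ((H : ℝ) - h) := by
  rw [optQ_leaf_late M B h _ hx hh, M.reward_node_late hh (M.node_leaf x hx) (Or.inr rfl),
    M.rate_safe hB]
  ring

theorem value_node_late (hB : B ⊆ M.arms) (h : ℕ) (hd : M.delay ≤ h) (hH : h ≤ H) {x : Fin S}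
    (hx : M.IsNode x) : M.value B h x = (1 / 2 + M.Δ) * ((H : ℝ) - h) := by
  have := M.nonempty_action
  rcases lt_or_ge h H with hh | hh
  · by_cases hl : x ∈ M.leaf
    · refine le_antisymm ?_ ?_
      · obtain ⟨a, ha⟩ := exists_optQ_eq_optValue (M.transition B) M.reward ⟨h, hh⟩ x
        rw [value, ← ha]
        by_cases has : a = M.safe
        · rw [has, M.optQ_leaf_late_safe hB hl hd]
        · exact (M.optQ_leaf_late_le hl hd has).trans (by simp)
      · exact (M.optQ_leaf_late_safe hB (h := ⟨h, hh⟩) hl hd).symm.trans_le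
          (optQ_le_optValue ⟨h, hh⟩ x M.safe)
    · refine optValue_eq_of_forall_optQ (h := ⟨h, hh⟩) fun a => ?_
      rw [optQ_inner M B _ a hx hl, M.reward_node_late hd hx (Or.inl hl),
        value_node_late hB (h + 1) (Nat.le_succ_of_le hd) hh (M.node_child x a)]
      push_cast
      ring
  · obtain rfl := le_antisymm hH hh
    rw [value, optValue_of_le hh, sub_self, mul_zero]
termination_by H - h

/-- Up to step `delay` each node has one of two values: the one that `safe` guarantees, and the
one that is attained if a special arm can be reached in time. -/
theorem value_node_early (hB : B ⊆ M.arms) (h : ℕ) (hd : h ≤ M.delay) {x : Fin S}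
    (hx : M.IsNode x) : M.value B h x = M.payoff / 2 + M.Δ * M.payoff ∨
      M.value B h x = M.payoff / 2 + 2 * (M.Δ * M.payoff) := by
  have := M.nonempty_action
  have hpos := M.Δ_mul_payoff_pos
  rcases hd.lt_or_eq with hlt | rfl
  · have hh : h < H := hlt.trans M.delay_lt
    obtain ⟨a, ha⟩ := exists_optQ_eq_optValue (M.transition B) M.reward ⟨h, hh⟩ x
    by_cases hl : x ∈ M.leaf
    · have hs := optQ_le_optValue (P := M.transition B) (r := M.reward) ⟨h, hh⟩ x M.safe
      rw [← ha, M.optQ_leaf_early B _ _ hl hlt, M.optQ_leaf_early B _ _ hl hlt,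
        M.rate_safe hB] at hs
      rw [value, ← ha, M.optQ_leaf_early B _ _ hl hlt]
      by_cases has : a = M.safe
      · rw [has, M.rate_safe hB]
        left
        ring
      · rcases M.rate_of_ne_safe (B := B) x has with hr | hr <;> rw [hr] at hs ⊢
        · right
          ring
        · nlinarith
    · rw [value, ← ha, optQ_inner M B _ a hx hl, M.reward_early _ _ hlt, zero_add]
      exact value_node_early hB (h + 1) hlt (M.node_child x a)
  · left
    rw [M.value_node_late hB _ le_rfl M.delay_lt.le hx, payoff]
    ring
termination_by M.delay - h

theorem gap_eq_zero_of_forall_optQ {h : Fin H} {x : Fin S} {c : ℝ}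
    (hc : ∀ a, optQ (M.transition B) M.reward h x a = c) (a : Fin A) :
    gap (M.transition B) M.reward h x a = 0 := by
  have := M.nonempty_action
  rw [gap, optValue_eq_of_forall_optQ hc, hc, sub_self]

theorem le_gap (hB : B ⊆ M.arms) (h : Fin H) (x : Fin S) (a : Fin A)
    (hpos : 0 < gap (M.transition B) M.reward h x a) :
    M.Δ * M.payoff ≤ gap (M.transition B) M.reward h x a := by
  have := M.nonempty_action
  have hD := M.Δ_mul_payoff_pos
  have hD6 := M.Δ_mul_payoff_le
  by_cases hx : M.IsNode x
  · have hgap : gap (M.transition B) M.reward h x a =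
        M.value B h x - optQ (M.transition B) M.reward h x a := rfl
    rw [hgap] at hpos ⊢
    rcases lt_or_ge (h : ℕ) M.delay with hd | hd
    · have hV := M.value_node_early hB h hd.le hx
      by_cases hl : x ∈ M.leaf
      · rw [M.optQ_leaf_early B h a hl hd] at hpos ⊢
        by_cases has : a = M.safe
        · rw [has, M.rate_safe hB] at hpos ⊢
          rcases hV with hV | hV <;> rw [hV] at hpos ⊢ <;> nlinarith
        · rcases M.rate_of_ne_safe (B := B) x has with hr | hr <;> rw [hr] at hpos ⊢ <;>
            rcases hV with hV | hV <;> rw [hV] at hpos ⊢ <;> nlinarith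
      · rw [M.optQ_inner B h a hx hl, M.reward_early _ _ hd] at hpos ⊢
        rcases hV with hV | hV <;>
          rcases M.value_node_early hB (h + 1) hd (M.node_child x a) with hV' | hV' <;>
          rw [hV, hV'] at hpos ⊢ <;> linarith
    · have hV := M.value_node_late hB h hd h.isLt.le hx
      by_cases hl : x ∈ M.leaf
      · by_cases has : a = M.safe
        · rw [has, M.optQ_leaf_late_safe hB hl hd, hV, sub_self] at hpos
          exact absurd hpos (lt_irrefl 0)
        · have hQ := M.optQ_leaf_late_le (B := B) hl hd has
          rw [hV]
          linarith
      · rw [M.optQ_inner B h a hx hl, M.reward_node_late hd hx (Or.inl hl), hV,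
          M.value_node_late hB (h + 1) (Nat.le_succ_of_le hd) h.isLt (M.node_child x a)] at hpos
        push_cast at hpos
        nlinarith
  · refine absurd hpos (le_of_eq ?_).not_gt
    by_cases h1 : x = M.start
    · rw [h1]
      exact M.gap_eq_zero_of_forall_optQ (fun a => M.optQ_start B h a) a
    by_cases h2 : x = M.good
    · rw [h2]
      refine M.gap_eq_zero_of_forall_optQ
        (c := (M.reward h M.good M.safe : ℝ) + M.value B (h + 1) M.good) (fun a => ?_) a
      rw [optQ_eq, sum_transition_good, value]
      congr 1
      rcases lt_or_ge (h : ℕ) M.delay with hd | hd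
      · rw [M.reward_early _ _ hd, M.reward_early _ _ hd]
      · rw [M.reward_good _ hd, M.reward_good _ hd]
    have h3 : x = M.bad := by
      by_contra h3
      exact hx ⟨h1, h2, h3⟩
    rw [h3]
    refine M.gap_eq_zero_of_forall_optQ (c := M.value B (h + 1) M.bad) (fun a => ?_) a
    rw [optQ_eq, sum_transition_bad, reward_bad, zero_add, value]

theorem isGapTAE (hB : B ⊆ M.arms) {ρ : ℝ} (hρ : 0 < ρ) (hρM : ρ ≤ M.Δ * M.payoff) :
    IsGapTAE ρ (M.transition B) {M.reward} := by
  refine ⟨Set.singleton_nonempty _, hρ, fun r hr => ?_⟩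
  rw [Set.mem_singleton_iff.1 hr]
  exact le_gapMin fun h x a hpos => hρM.trans (M.le_gap hB h x a hpos)

/-! ### No policy is good for the baseline and for an alternative -/

theorem isNode_of_reachIn {t : ℕ} {x : Fin S} (hx : ReachIn M.root M.leaf M.child t x) :
    M.IsNode x := by
  cases t with
  | zero =>
    rw [ReachIn] at hx
    rw [hx]
    exact M.node_root
  | succ t =>
    obtain ⟨y, a, -, -, rfl⟩ := hx
    exact M.node_child y a

theorem value_le_value_root {t : ℕ} {x : Fin S} (ht : t + 1 ≤ M.delay)
    (hx : ReachIn M.root M.leaf M.child t x) : M.value B (t + 1) x ≤ M.value B 1 M.root := by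
  have := M.nonempty_action
  induction t generalizing x with
  | zero =>
    rw [ReachIn] at hx
    rw [hx]
  | succ t ih =>
    obtain ⟨y, a, hyl, hy, rfl⟩ := hx
    refine le_trans ?_ (ih (by omega) hy)
    have hh : t + 1 < H := by have := M.delay_lt; omega
    have hQ := optQ_le_optValue (P := M.transition B) (r := M.reward) ⟨t + 1, hh⟩ y a
    rw [M.optQ_inner B _ a (M.isNode_of_reachIn hy) hyl, M.reward_early _ _ (by simpa using ht),
      zero_add] at hQ
    exact hQ

theorem le_value_root {l : Fin S × Fin A} (hl : l ∈ M.arms) :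
    M.payoff / 2 + 2 * (M.Δ * M.payoff) ≤ M.value {l} 1 M.root := by
  have := M.nonempty_action
  have hleaf := (M.mem_arms.1 hl).1
  obtain ⟨t, ht, hr⟩ := M.reach _ hleaf
  refine le_trans ?_ (M.value_le_value_root (by omega) hr)
  have hh : t + 1 < H := by have := M.delay_lt; omega
  have hQ := optQ_le_optValue (P := M.transition {l}) (r := M.reward) ⟨t + 1, hh⟩ l.1 l.2
  rw [M.optQ_leaf_early _ _ _ hleaf (Nat.lt_of_succ_le ht), rate,
    if_pos (Finset.mem_singleton_self l)] at hQ
  refine le_trans (le_of_eq ?_) hQ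
  ring

/-- At no arm do the probabilities of `good` under the baseline and under an instance with
special arms add up to more than twice that of `safe`. -/
theorem policyValue_add_policyValue_le (hB : B ⊆ M.arms) (π : Policy S A H) (h : ℕ)
    (hd : h ≤ M.delay) {x : Fin S} (hx : M.IsNode x) :
    policyValue (M.transition ∅) M.reward π h x + policyValue (M.transition B) M.reward π h x ≤
      M.payoff + 2 * (M.Δ * M.payoff) := by
  have := M.nonempty_action
  rcases hd.lt_or_eq with hlt | rfl
  · have hh : h < H := hlt.trans M.delay_lt
    have hQ : ∀ a, policyQ (M.transition ∅) M.reward π ⟨h, hh⟩ x a +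
        policyQ (M.transition B) M.reward π ⟨h, hh⟩ x a ≤ M.payoff + 2 * (M.Δ * M.payoff) := by
      intro a
      rw [policyQ, policyQ, M.reward_early _ _ hlt, zero_add, zero_add]
      by_cases hl : x ∈ M.leaf
      · have hpay := M.one_le_payoff
        have hΔ := M.Δ_pos
        rw [sum_transition_leaf M _ a _ hl, sum_transition_leaf M _ a _ hl, policyValue_bad,
          policyValue_bad, policyValue_good _ _ _ _ hh, policyValue_good _ _ _ _ hh,
          max_eq_right (Nat.succ_le_of_lt hlt), mul_zero, mul_zero, add_zero, add_zero,
          ← add_mul]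
        have hrate : M.rate ∅ x a + M.rate B x a ≤ 1 + 2 * M.Δ := by
          by_cases has : a = M.safe
          · rw [has, M.rate_safe hB, M.rate_safe (Finset.empty_subset _)]
            linarith
          · rw [rate, if_neg (Finset.notMem_empty _), if_neg has]
            rcases M.rate_of_ne_safe (B := B) x has with hr | hr <;> rw [hr] <;> linarith
        refine (mul_le_mul_of_nonneg_right hrate (zero_le_one.trans hpay)).trans_eq ?_
        ring
      · rw [sum_transition_inner M _ a _ hx hl, sum_transition_inner M _ a _ hx hl]
        exact policyValue_add_policyValue_le hB π (h + 1) hlt (M.node_child x a)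
    rw [policyValue_of_lt hh, policyValue_of_lt hh, ← Finset.sum_add_distrib]
    refine (Finset.sum_le_sum fun a _ => (mul_add _ _ _).symm.trans_le
      (mul_le_mul_of_nonneg_left (hQ a) (stdSimplex.zero_le _ a))).trans_eq ?_
    rw [← Finset.sum_mul, stdSimplex.sum_eq_one, one_mul]
  · have h0 := policyValue_le_optValue (P := M.transition ∅) (r := M.reward) π M.delay x
    have h1 := policyValue_le_optValue (P := M.transition B) (r := M.reward) π M.delay x
    have e0 := M.value_node_late (Finset.empty_subset _) _ le_rfl M.delay_lt.le hx
    have e1 := M.value_node_late hB _ le_rfl M.delay_lt.le hx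
    rw [value] at e0 e1
    rw [e0] at h0
    rw [e1] at h1
    rw [payoff]
    linarith
termination_by M.delay - h

theorem value_start (B : Finset (Fin S × Fin A)) :
    M.value B 0 M.start = M.entry * M.value B 1 M.root := by
  have := M.nonempty_action
  exact optValue_eq_of_forall_optQ (h := ⟨0, (Nat.zero_le _).trans_lt M.delay_lt⟩)
    fun a => M.optQ_start B _ a

theorem policyValue_start (B : Finset (Fin S × Fin A)) (π : Policy S A H) :
    policyValue (M.transition B) M.reward π 0 M.start =
      M.entry * policyValue (M.transition B) M.reward π 1 M.root := by
  refine policyValue_eq_of_forall_policyQ ((Nat.zero_le _).trans_lt M.delay_lt) fun a => ?_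
  rw [policyQ, reward_start, sum_transition_start, policyValue_bad, mul_zero, add_zero, zero_add]

theorem suboptimal_or_suboptimal {l : Fin S × Fin A} (hl : l ∈ M.arms) {ε : ℝ}
    (hε : 2 * ε < M.entry * (M.Δ * M.payoff)) (π : Policy S A H) :
    ε < optValue (M.transition ∅) M.reward 0 M.start -
        policyValue (M.transition ∅) M.reward π 0 M.start ∨
      ε < optValue (M.transition {l}) M.reward 0 M.start -
        policyValue (M.transition {l}) M.reward π 0 M.start := by
  have hsub : {l} ⊆ M.arms := Finset.singleton_subset_iff.2 hl
  have h1 : 1 ≤ M.delay := one_le_two.trans M.two_le_delay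
  have hsum := M.policyValue_add_policyValue_le hsub π 1 h1 M.node_root
  have hl1 := M.le_value_root hl
  have h0 : M.payoff / 2 + M.Δ * M.payoff ≤ M.value ∅ 1 M.root := by
    have hD := M.Δ_mul_payoff_pos
    rcases M.value_node_early (Finset.empty_subset _) 1 h1 M.node_root with h | h <;> rw [h]
    linarith
  have e0 := M.value_start ∅
  have e1 := M.value_start {l}
  rw [value] at e0 e1
  rw [e0, e1, policyValue_start, policyValue_start]
  have hp : (0 : ℝ) ≤ M.entry := M.entry.2.1
  by_contra hcon
  push Not at hcon
  nlinarith [hcon.1, hcon.2]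

end Values

/-! ### The information that an episode reveals -/

/-- The log-likelihood ratio of one transition between the baseline and the instance with the
special arm `l`. -/
noncomputable def logRatio (l : Fin S × Fin A) (x : Fin S) (a : Fin A) (y : Fin S) : ℝ :=
  if (x, a) = l then
    if y = M.good then -Real.log (1 + 4 * M.Δ) else -Real.log (1 - 4 * M.Δ)
  else 0

theorem transition_singleton_eq {l : Fin S × Fin A} (hl : l ∈ M.arms) (x : Fin S) (a : Fin A)
    (y : Fin S) : (M.transition {l} x a) y =
      (M.transition ∅ x a) y * Real.exp (-M.logRatio l x a y) := by
  have hΔ := M.Δ_pos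
  have hΔ6 := M.Δ_le
  rw [logRatio]
  by_cases hxa : (x, a) = l
  · subst hxa
    obtain ⟨hx, ha⟩ := M.mem_arms.1 hl
    rw [if_pos rfl, transition_leaf M _ a hx, transition_leaf M _ a hx, twoPoint_apply,
      twoPoint_apply]
    simp only [rate, Finset.mem_singleton, if_true, Finset.notMem_empty, if_false, if_neg ha]
    by_cases hy : y = M.good
    · rw [if_pos hy, neg_neg, Real.exp_log (by linarith), hy, Pi.single_eq_same,
        Pi.single_eq_of_ne M.good_ne_bad]
      ring
    · rw [if_neg hy, neg_neg, Real.exp_log (by linarith), Pi.single_eq_of_ne hy]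
      ring
  · rw [if_neg hxa, neg_zero, Real.exp_zero, mul_one]
    have hrate : M.rate {l} x a = M.rate ∅ x a := by
      rw [rate, rate, if_neg (by simpa using hxa), if_neg (Finset.notMem_empty _)]
    simp only [transition, hrate]

theorem sum_logRatio (x : Fin S) (a : Fin A) (y : Fin S) :
    ∑ l ∈ M.arms, M.logRatio l x a y = if (x, a) ∈ M.arms then
      if y = M.good then -Real.log (1 + 4 * M.Δ) else -Real.log (1 - 4 * M.Δ) else 0 := by
  simp only [logRatio, Finset.sum_ite_eq]

/-- The relative entropy between the laws at an arm with and without the bonus. -/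
theorem armEntropy_le :
    1 / 2 * -Real.log (1 + 4 * M.Δ) + 1 / 2 * -Real.log (1 - 4 * M.Δ) ≤ 16 * M.Δ ^ 2 := by
  have hΔ := M.Δ_pos
  have hΔ6 := M.Δ_le
  have hsq : M.Δ ^ 2 ≤ 1 / 36 := by nlinarith
  have hpos : 0 < (1 + 4 * M.Δ) * (1 - 4 * M.Δ) := by nlinarith
  have hlog := Real.one_sub_inv_le_log_of_pos hpos
  rw [Real.log_mul (by linarith) (by linarith)] at hlog
  have hinv : ((1 + 4 * M.Δ) * (1 - 4 * M.Δ))⁻¹ ≤ 1 + 32 * M.Δ ^ 2 := by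
    rw [inv_le_iff_one_le_mul₀ hpos]
    nlinarith [sq_nonneg M.Δ]
  linarith

/-- The potential that bounds the information still to be revealed in an episode: at most one
arm is tried, and only if `root` is entered. -/
noncomputable def potential (x : Fin S) : ℝ :=
  if x = M.start then M.entry * (16 * M.Δ ^ 2)
  else if x = M.good ∨ x = M.bad then 0 else 16 * M.Δ ^ 2

theorem potential_nonneg (x : Fin S) : 0 ≤ M.potential x := by
  have hp : (0 : ℝ) ≤ M.entry := M.entry.2.1
  rw [potential]
  split_ifs <;> positivity

theorem potential_node {x : Fin S} (hx : M.IsNode x) : M.potential x = 16 * M.Δ ^ 2 := by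
  rw [potential, if_neg hx.1, if_neg (by rw [not_or]; exact hx.2)]

theorem sum_transition_mul_potential_le (x : Fin S) (a : Fin A) :
    ∑ y, (M.transition ∅ x a) y * ((∑ l ∈ M.arms, M.logRatio l x a y) + M.potential y) ≤
      M.potential x := by
  have hgood : M.potential M.good = 0 := by
    rw [potential, if_neg M.good_ne_start, if_pos (Or.inl rfl)]
  have hbad : M.potential M.bad = 0 := by
    rw [potential, if_neg M.bad_ne_start, if_pos (Or.inr rfl)]
  simp only [sum_logRatio]
  by_cases hl : x ∈ M.leaf
  · rw [sum_transition_leaf M _ a _ hl, hgood, hbad, M.potential_node (M.node_leaf x hl),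
      if_pos rfl, if_neg M.good_ne_bad.symm]
    by_cases ha : a = M.safe
    · have hna : (x, a) ∉ M.arms := fun h => (M.mem_arms.1 h).2 ha
      rw [if_neg hna, if_neg hna, add_zero, mul_zero, mul_zero, add_zero]
      positivity
    · have hna : (x, a) ∈ M.arms := M.mem_arms.2 ⟨hl, ha⟩
      rw [if_pos hna, if_pos hna, rate, if_neg (Finset.notMem_empty _), if_neg ha]
      refine le_trans (le_of_eq ?_) M.armEntropy_le
      ring
  · have hna : (x, a) ∉ M.arms := fun h => hl (M.mem_arms.1 h).1
    simp only [if_neg hna, zero_add]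
    by_cases h1 : x = M.start
    · rw [h1, sum_transition_start, hbad, M.potential_node M.node_root, mul_zero, add_zero,
        potential, if_pos rfl]
    by_cases h2 : x = M.good
    · rw [h2, sum_transition_good]
    by_cases h3 : x = M.bad
    · rw [h3, sum_transition_bad]
    have hx : M.IsNode x := ⟨h1, h2, h3⟩
    rw [sum_transition_inner M _ a _ hx hl, M.potential_node hx,
      M.potential_node (M.node_child x a)]

/-- An algorithm that is PAC cannot tell the candidates of one layout apart in fewer episodes: it
needs `log (1 / δ)` units of information about each arm, and `potential` limits what an episode
yields. -/
theorem le_expectedEpisodes {ρ ε δ : ℝ} (hρ : 0 < ρ) (hρM : ρ ≤ M.Δ * M.payoff) (hε : 0 ≤ ε)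
    (hεM : 2 * ε < M.entry * (M.Δ * M.payoff)) (hδ : 0 < δ) (hδ8 : δ < 1 / 8)
    {alg : Set (Reward S A H) → Algorithm S A H} (halg : IsPAC alg M.start ρ ε δ) :
    ENNReal.ofReal (M.arms.card * (Real.log (1 / 8 / δ) / 2) / (M.entry * (16 * M.Δ ^ 2))) ≤
      (alg {M.reward}).expectedEpisodes M.start (M.transition ∅) := by
  have herr : ∀ B ⊆ M.arms, (alg {M.reward}).errorProb M.start (M.transition B) M.reward ε <
      ENNReal.ofReal δ := fun B hB =>
    halg _ _ (M.isGapTAE hB hρ hρM) _ (Set.mem_singleton _)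
  have hentry : (0 : ℝ) < M.entry :=
    pos_of_mul_pos_left ((mul_nonneg zero_le_two hε).trans_lt hεM) M.Δ_mul_payoff_pos.le
  have hΔ := M.Δ_pos
  refine (alg {M.reward}).le_expectedEpisodes_of_alternatives M.start M.arms
    (P₁ := fun l => M.transition {l}) (f := M.logRatio)
    (fun l hl => M.transition_singleton_eq hl) hδ hδ8 (herr ∅ (Finset.empty_subset _))
    (fun l hl => herr {l} (Finset.singleton_subset_iff.2 hl))
    (fun l hl => M.suboptimal_or_suboptimal hl hεM) (by positivity) M.potential
    M.potential_nonneg ?_ M.sum_transition_mul_potential_le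
  rw [potential, if_pos rfl]

end Maze

/-! ### Numbering the states -/

section Numbering

variable {S A H : ℕ}

/-- The states numbered such that `x₁` has the number `0`. -/
def state (x₁ : Fin S) (i : ℕ) (hi : i < S) : Fin S :=
  Equiv.swap x₁ ⟨0, (Nat.zero_le i).trans_lt hi⟩ ⟨i, hi⟩

/-- The number of a state, if `x₁` has the number `0`. -/
def number (x₁ x : Fin S) : ℕ := (Equiv.swap x₁ ⟨0, (Nat.zero_le _).trans_lt x₁.isLt⟩ x : Fin S)

theorem number_lt (x₁ x : Fin S) : number x₁ x < S := Fin.isLt _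

theorem number_state (x₁ : Fin S) (i : ℕ) (hi : i < S) : number x₁ (state x₁ i hi) = i := by
  rw [number, state, Equiv.swap_apply_self]

theorem state_number (x₁ x : Fin S) : state x₁ (number x₁ x) (number_lt x₁ x) = x := by
  simp [number, state]

theorem number_self (x₁ : Fin S) : number x₁ x₁ = 0 := by
  simp [number]

theorem ne_of_number_ne {x₁ x y : Fin S} (h : number x₁ x ≠ number x₁ y) : x ≠ y :=
  fun hxy => h (congrArg _ hxy)

theorem state_ne_state (x₁ : Fin S) {i j : ℕ} (hi : i < S) (hj : j < S) (h : i ≠ j) :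
    state x₁ i hi ≠ state x₁ j hj :=
  ne_of_number_ne (x₁ := x₁) (by rwa [number_state, number_state])

theorem state_ne_self (x₁ : Fin S) {i : ℕ} (hi : i < S) (h : i ≠ 0) : state x₁ i hi ≠ x₁ :=
  ne_of_number_ne (x₁ := x₁) (by rwa [number_state, number_self])

end Numbering

/-! ### Trees in heap order -/

section Heap

variable {S A H : ℕ}

/-- The maze on the numbered states: the states `1` and `2` are `good` and `bad`, the root is `3`,
and the graph of the nodes is a parameter. With `Δ = 3 ρ / (H - T)` and entry probability `ε / ρ`
all positive gaps are at least `3 ρ`, and a wrong choice in the tree costs more than `2 ε`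
altogether. -/
noncomputable def mkMaze (hS : 5 ≤ S) (x₁ : Fin S) (safe : Fin A) (leaf : Finset (Fin S))
    (child : Fin S → Fin A → Fin S) (T : ℕ) (hT2 : 2 ≤ T) (hTH : T < H)
    (hleaf : ∀ x ∈ leaf, 3 ≤ number x₁ x) (hchild : ∀ x a, 3 ≤ number x₁ (child x a))
    (hreach : ∀ x ∈ leaf, ∃ t, t + 2 ≤ T ∧ ReachIn (state x₁ 3 (by omega)) leaf child t x)
    {ρ ε : ℝ} (hρ : 0 < ρ) (hρ18 : ρ < 1 / 18) (hε : 0 < ε) (hερ : ε < ρ) : Maze S A H :=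
  have hnode : ∀ x, 3 ≤ number x₁ x → x ≠ x₁ ∧ x ≠ state x₁ 1 (by omega) ∧
      x ≠ state x₁ 2 (by omega) := fun x hx =>
    ⟨ne_of_number_ne (x₁ := x₁) (by rw [number_self]; omega),
      ne_of_number_ne (x₁ := x₁) (by rw [number_state]; omega),
      ne_of_number_ne (x₁ := x₁) (by rw [number_state]; omega)⟩
  have hL : 0 < (H : ℝ) - T := sub_pos.2 (Nat.cast_lt.2 hTH)
  { start := x₁
    good := state x₁ 1 (by omega)
    bad := state x₁ 2 (by omega)
    root := state x₁ 3 (by omega)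
    safe := safe
    leaf := leaf
    child := child
    delay := T
    entry := ⟨ε / ρ, (div_pos hε hρ).le, (div_le_one hρ).2 hερ.le⟩
    Δ := 3 * ρ / ((H : ℝ) - T)
    good_ne_start := state_ne_self x₁ _ one_ne_zero
    bad_ne_start := state_ne_self x₁ _ two_ne_zero
    good_ne_bad := state_ne_state x₁ _ _ (by omega)
    node_root := hnode _ (by rw [number_state])
    node_child := fun x a => hnode _ (hchild x a)
    node_leaf := fun x hx => hnode x (hleaf x hx)
    two_le_delay := hT2
    delay_lt := hTH
    Δ_pos := by positivity
    Δ_mul_le := by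
      rw [div_mul_cancel₀ _ hL.ne']
      linarith
    reach := hreach }

theorem le_expectedEpisodes_of_graph (hS : 5 ≤ S) (x₁ : Fin S) (safe : Fin A)
    (leaf : Finset (Fin S)) (child : Fin S → Fin A → Fin S) (T : ℕ) (hT2 : 2 ≤ T) (hTH : T < H)
    (hleaf : ∀ x ∈ leaf, 3 ≤ number x₁ x) (hchild : ∀ x a, 3 ≤ number x₁ (child x a))
    (hreach : ∀ x ∈ leaf, ∃ t, t + 2 ≤ T ∧ ReachIn (state x₁ 3 (by omega)) leaf child t x)
    {ρ ε δ : ℝ} (hρ : 0 < ρ) (hρ18 : ρ < 1 / 18) (hε : 0 < ε) (hερ : ε < ρ) (hδ : 0 < δ)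
    (hδ8 : δ < 1 / 8) {alg : Set (Reward S A H) → Algorithm S A H} (halg : IsPAC alg x₁ ρ ε δ) :
    ∃ (P : Transition S A) (R : Set (Reward S A H)), IsGapTAE ρ P R ∧
      ENNReal.ofReal ((leaf.card * (A - 1) : ℕ) * ((H : ℝ) - T) ^ 2 / (288 * (ρ * ε)) *
        Real.log (1 / 8 / δ)) ≤ (alg R).expectedEpisodes x₁ P := by
  let M : Maze S A H := mkMaze hS x₁ safe leaf child T hT2 hTH hleaf hchild hreach hρ hρ18 hε hερ
  have hL : 0 < (H : ℝ) - T := sub_pos.2 (Nat.cast_lt.2 hTH)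
  have hgap : M.Δ * M.payoff = 3 * ρ := div_mul_cancel₀ _ hL.ne'
  have hentry : (M.entry : ℝ) = ε / ρ := rfl
  have hΔ : M.Δ = 3 * ρ / ((H : ℝ) - T) := rfl
  have hcard : M.arms.card = leaf.card * (A - 1) := M.card_arms
  refine ⟨M.transition ∅, {M.reward}, M.isGapTAE (Finset.empty_subset _) hρ ?_, ?_⟩
  · rw [hgap]
    linarith
  refine le_trans (le_of_eq ?_) (M.le_expectedEpisodes hρ ?_ hε.le ?_ hδ hδ8 halg)
  · rw [hcard, hentry, hΔ]
    congr 1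
    field_simp
    ring
  · rw [hgap]
    linarith
  · have h3 : ε / ρ * (3 * ρ) = 3 * ε := by
      field_simp
    rw [hgap, hentry, h3]
    linarith

/-- The leaves of the tree in heap order on the states with the numbers `3, …, S - 1`: those
without a binary child. -/
def heapLeaf (x₁ : Fin S) : Finset (Fin S) :=
  Finset.univ.filter fun x => 3 ≤ number x₁ x ∧ S - 3 ≤ 2 * (number x₁ x - 3) + 1

/-- The node `i` of the heap has the children `A * i + 1, …, A * i + A`; those that do not exist
are replaced by the root. Node `i` is the state with the number `i + 3`. -/
def heapChild (hS : 5 ≤ S) (x₁ x : Fin S) (a : Fin A) : Fin S :=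
  if h : A * (number x₁ x - 3) + 1 + a + 3 < S then
    state x₁ (A * (number x₁ x - 3) + 1 + a + 3) h
  else state x₁ 3 (by omega)

theorem three_le_number_heapChild (hS : 5 ≤ S) (x₁ x : Fin S) (a : Fin A) :
    3 ≤ number x₁ (heapChild hS x₁ x a) := by
  rw [heapChild]
  split <;> rw [number_state]
  omega

theorem exists_reachIn_heap (hS : 5 ≤ S) (hA : 2 ≤ A) (x₁ : Fin S) (j : ℕ) (hj : j + 3 < S) :
    ∃ t, A ^ t ≤ A * j + 1 ∧ ReachIn (state x₁ 3 (by omega)) (heapLeaf x₁)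
      (heapChild (A := A) hS x₁) t (state x₁ (j + 3) hj) := by
  induction j using Nat.strong_induction_on with
  | _ j ih =>
    rcases Nat.eq_zero_or_pos j with rfl | hpos
    · exact ⟨0, by simp, rfl⟩
    -- The parent of node `j` is node `(j - 1) / A`.
    have hdiv := Nat.div_add_mod (j - 1) A
    have hmod := Nat.mod_lt (j - 1) (show 0 < A by omega)
    have hle : 2 * ((j - 1) / A) ≤ A * ((j - 1) / A) := Nat.mul_le_mul_right _ hA
    have hi : (j - 1) / A < j := by omega
    obtain ⟨t, ht, hr⟩ := ih ((j - 1) / A) hi (by omega)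
    refine ⟨t + 1, ?_, state x₁ ((j - 1) / A + 3) (by omega), ⟨(j - 1) % A, hmod⟩, ?_, hr, ?_⟩
    · rw [pow_succ']
      exact (Nat.mul_le_mul_left A (ht.trans (by omega))).trans (Nat.le_succ _)
    · simp only [heapLeaf, Finset.mem_filter, number_state]
      omega
    · have hnum : A * ((j - 1) / A) + 1 + (j - 1) % A + 3 = j + 3 := by omega
      simp only [heapChild, number_state, Nat.add_sub_cancel, hnum, dif_pos hj]

theorem card_heapLeaf (hS : 5 ≤ S) (x₁ : Fin S) : S ≤ 5 * (heapLeaf x₁).card := by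
  have hinj : ((Finset.Ico (3 + (S - 3) / 2) S).attach.image fun i =>
      state x₁ i.1 (Finset.mem_Ico.1 i.2).2).card = S - (3 + (S - 3) / 2) := by
    rw [Finset.card_image_of_injective, Finset.card_attach, Nat.card_Ico]
    intro i j hij
    have h := congrArg (number x₁) hij
    simp only [number_state] at h
    exact Subtype.ext h
  have hle := Finset.card_le_card (t := heapLeaf x₁) (s :=
    (Finset.Ico (3 + (S - 3) / 2) S).attach.image fun i =>
      state x₁ i.1 (Finset.mem_Ico.1 i.2).2) <| by
    intro x hx
    obtain ⟨⟨i, hi⟩, -, rfl⟩ := Finset.mem_image.1 hx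
    have := Finset.mem_Ico.1 hi
    simp only [heapLeaf, Finset.mem_filter, Finset.mem_univ, true_and, number_state]
    omega
  omega

end Heap

/-! ### The lower bound -/

/-- The lower bound for a fixed size: a single leaf and a single paying step suffice, as the
constant may absorb the dependence on the size. -/
theorem episodeLowerBound_of_size {S A H : ℕ} (hS : 5 ≤ S) (hA : 2 ≤ A) (hH : 3 ≤ H) :
    EpisodeLowerBound S A H (1 / (288 * (H : ℝ) ^ 2 * S * A)) (1 / 8) (1 / 18) (1 / 8) := by
  intro ρ ε δ hρ hρ18 hε hερ hδ hδ8 x₁ alg halg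
  obtain ⟨P, R, hPR, hK⟩ := le_expectedEpisodes_of_graph hS x₁ (⟨0, by omega⟩ : Fin A)
    {state x₁ 3 (by omega)} (fun _ _ => state x₁ 3 (by omega)) 2 le_rfl (by omega)
    (fun x hx => by rw [Finset.mem_singleton.1 hx, number_state])
    (fun _ _ => by rw [number_state])
    (fun x hx => ⟨0, le_rfl, Finset.mem_singleton.1 hx⟩) hρ hρ18 hε hερ hδ hδ8 halg
  refine ⟨P, R, hPR, le_trans (ENNReal.ofReal_le_ofReal (mul_le_mul_of_nonneg_right ?_
    (Real.log_nonneg ((one_le_div hδ).2 hδ8.le)))) hK⟩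
  have hS0 : (0 : ℝ) < S := Nat.cast_pos.2 (by omega)
  have hA0 : (0 : ℝ) < A := Nat.cast_pos.2 (by omega)
  have hH0 : (3 : ℝ) ≤ H := by exact_mod_cast hH
  have hn : (1 : ℝ) ≤ (Finset.card {state x₁ 3 (by omega : 3 < S)} * (A - 1) : ℕ) := by
    rw [Finset.card_singleton, one_mul, Nat.one_le_cast]
    omega
  have heq : 1 / (288 * (H : ℝ) ^ 2 * S * A) * ((H : ℝ) ^ 2 * S * A / (ρ * ε)) =
      1 / (288 * (ρ * ε)) := by
    field_simp
  rw [heq]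
  refine div_le_div_of_nonneg_right ?_ (by positivity)
  refine one_le_mul_of_one_le_of_one_le hn (one_le_pow₀ ?_)
  push_cast
  linarith

/-- The lower bound with universal constants: at least a fifth of the states are leaves, at least
half of the actions are arms, and `good` pays in at least three tenths of the steps. -/
theorem episodeLowerBound_universal {S A H : ℕ} (hS : 5 ≤ S) (hA : 2 ≤ A)
    (hH : 4 + 2 * Nat.log A S ≤ H) (hH5 : 5 ≤ H) :
    EpisodeLowerBound S A H (1 / 32000) (1 / 8) (1 / 18) (1 / 8) := by
  intro ρ ε δ hρ hρ18 hε hερ hδ hδ8 x₁ alg halg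
  have hreach : ∀ x ∈ heapLeaf x₁, ∃ t, t + 2 ≤ 3 + Nat.log A S ∧
      ReachIn (state x₁ 3 (by omega)) (heapLeaf x₁) (heapChild (A := A) hS x₁) t x := by
    intro x hx
    have h3 : 3 ≤ number x₁ x := (Finset.mem_filter.1 hx).2.1
    have hlt := number_lt x₁ x
    obtain ⟨t, ht, hr⟩ := exists_reachIn_heap hS hA x₁ (number x₁ x - 3) (by omega)
    have hsub : number x₁ x - 3 + 3 = number x₁ x := by omega
    simp only [hsub, state_number] at hr
    refine ⟨t, ?_, hr⟩
    have hpow : A ^ t ≤ S * A := by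
      refine ht.trans ?_
      have : A * (number x₁ x - 3) + A ≤ S * A := by
        rw [← Nat.mul_succ, mul_comm]
        exact Nat.mul_le_mul_right _ (by omega)
      omega
    have hlog := Nat.le_log_of_pow_le (by omega) hpow
    rw [Nat.log_mul_base (by omega) (by omega)] at hlog
    omega
  obtain ⟨P, R, hPR, hK⟩ := le_expectedEpisodes_of_graph hS x₁ (⟨0, by omega⟩ : Fin A)
    (heapLeaf x₁) (heapChild hS x₁) (3 + Nat.log A S) (by omega) (by omega)
    (fun x hx => (Finset.mem_filter.1 hx).2.1)
    (fun x a => three_le_number_heapChild hS x₁ x a) hreach hρ hρ18 hε hερ hδ hδ8 halg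
  refine ⟨P, R, hPR, le_trans (ENNReal.ofReal_le_ofReal (mul_le_mul_of_nonneg_right ?_
    (Real.log_nonneg ((one_le_div hδ).2 hδ8.le)))) hK⟩
  have hcard : (S : ℝ) ≤ 5 * (heapLeaf x₁).card := by exact_mod_cast card_heapLeaf hS x₁
  have hact : (A : ℝ) ≤ 2 * (A - 1 : ℕ) := by
    have : A ≤ 2 * (A - 1) := by omega
    exact_mod_cast this
  have hpay : 3 / 10 * (H : ℝ) ≤ (H : ℝ) - (3 + Nat.log A S : ℕ) := by
    have h1 : (4 : ℝ) + 2 * Nat.log A S ≤ H := by exact_mod_cast hH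
    have h2 : (5 : ℝ) ≤ H := by exact_mod_cast hH5
    push_cast
    linarith
  have hsq : (3 / 10 * (H : ℝ)) ^ 2 ≤ ((H : ℝ) - (3 + Nat.log A S : ℕ)) ^ 2 :=
    pow_le_pow_left₀ (by positivity) hpay 2
  have hSA : (S : ℝ) * A / 10 ≤ ((heapLeaf x₁).card * (A - 1) : ℕ) := by
    have := mul_le_mul hcard hact (Nat.cast_nonneg _) (by positivity)
    rw [Nat.cast_mul]
    linarith
  have hprod := mul_le_mul hSA hsq (by positivity) (Nat.cast_nonneg _)
  have heq : 1 / 32000 * ((H : ℝ) ^ 2 * S * A / (ρ * ε)) =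
      (S * A / 10 * (3 / 10 * (H : ℝ)) ^ 2) / (288 * (ρ * ε)) := by
    field_simp
    ring
  rw [heq]
  exact div_le_div_of_nonneg_right hprod (by positivity)

theorem theorem2 :
    (∀ S A H : ℕ, 5 ≤ S → 2 ≤ A → 2 + Real.logb A S ≤ H →
      ∃ c₁ c₂ ρ₀ δ₀ : ℝ, 0 < c₁ ∧ 0 < c₂ ∧ 0 < ρ₀ ∧ 0 < δ₀ ∧
        EpisodeLowerBound S A H c₁ c₂ ρ₀ δ₀) ∧
    (∃ c₁ c₂ ρ₀ δ₀ : ℝ, 0 < c₁ ∧ 0 < c₂ ∧ 0 < ρ₀ ∧ 0 < δ₀ ∧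
      ∀ S A H : ℕ, 5 ≤ S → 2 ≤ A → 2 * (2 + Real.logb A S) ≤ H →
        EpisodeLowerBound S A H c₁ c₂ ρ₀ δ₀) := by
  have hlogb : ∀ S A : ℕ, 5 ≤ S → 2 ≤ A → 0 < Real.logb A S := fun S A hS hA =>
    Real.logb_pos (by exact_mod_cast hA) (by exact_mod_cast (by omega : 1 < S))
  refine ⟨fun S A H hS hA hH => ?_, 1 / 32000, 1 / 8, 1 / 18, 1 / 8, by norm_num, by norm_num,
    by norm_num, by norm_num, fun S A H hS hA hH => ?_⟩
  · have h3 : 3 ≤ H := by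
      have h2 : (2 : ℝ) < H := by linarith [hlogb S A hS hA]
      exact_mod_cast h2
    have hS0 : (0 : ℝ) < S := Nat.cast_pos.2 (by omega)
    have hA0 : (0 : ℝ) < A := Nat.cast_pos.2 (by omega)
    have hH0 : (0 : ℝ) < H := Nat.cast_pos.2 (by omega)
    exact ⟨_, _, _, _, by positivity, by norm_num, by norm_num, by norm_num,
      episodeLowerBound_of_size hS hA h3⟩
  · have h5 : 5 ≤ H := by
      have h4 : (4 : ℝ) < H := by linarith [hlogb S A hS hA]
      exact_mod_cast h4
    have hlog : ((4 + 2 * Nat.log A S : ℕ) : ℝ) ≤ H := by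
      have := Real.natLog_le_logb S A
      push_cast
      linarith
    exact episodeLowerBound_universal hS hA (Nat.cast_le.1 hlog) h5
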